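/- Let $\alpha,\beta>0$. Consider $n$ agents and $m=m(n)$ indivisible items, and write $r=\lfloor m/n\rfloor$, $q=m-rn$. The utilities $u_i(j)$, for agents $i\in\{1,\dots,n\}$ and items $j\in\{1,\dots,m\}$, are drawn independently from a fixed probability distribution $\mathcal D$ supported on $[0,1]$ that has a density $f$ with $\alpha\le f(x)\le\beta$ for all $x\in[0,1]$. Utilities are additive: $u_i(S)=\sum_{j\in S}u_i(j)$. An allocation is a partition $(M_1,\dots,M_n)$ of the items into $n$ bundles. It is envy-free if $u_i(M_i)\ge u_i(M_{i'})$ for all $i,i'$, and EFX if $u_i(M_i)\ge u_i(M_{i'}\setminus\{j\})$ for all $i,i'$ and all $j\in M_{i'}$. Logarithms are to base $2$ and asymptotics are for $n\to\infty$. Say that a deterministic allocation algorithm $\mathcal A$ (mapping utility profiles measurably to families of bundles) has the Manurangsi–Suksompong guarantee with constant $C_0$ for $\mathcal D$ if, whenever $n$ divides $m$ and $2n\le m\le 2^{o(n)}$, with probability $1-o(1)$ it outputs an envy-free allocation $(M_1,\dots,M_n)$ with $|M_1|=\dots=|M_n|$ and $u_i(j)\ge 1-C_0\frac{\log m}{n}$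 for all $i$ and all $j\in M_i$. Given $\mathcal A$, the EFX algorithm works as follows: run $\mathcal A$ on the first $rn$ items to get $(M^0_1,\dots,M^0_n)$, then give the $q$ leftover items to the agents $n-q+1,\dots,n$, one item each, in an arbitrary manner. Theorem. There are a constant $C_0$ and an algorithm $\mathcal A$, depending only on $\alpha,\beta$, such that $\mathcal A$ has this guarantee with constant $C_0$ for every such $\mathcal D$. Moreover, for every $C_0$ there is a constant $C$, depending only on $\alpha,\beta,C_0$, such that for every such $\mathcal D$ and every algorithm $\mathcal A$ that has the guarantee with constant $C_0$ for $\mathcal D$ the following holds. Let $m=m(n)$ satisfy $r\ge 2$ for all large $n$ and, along those $n$ with $q=0$ (if there are infinitely many), $\log m=o(n)$. Then the EFX algorithm outputs an EFX allocation, whatever choices are made when handing out the leftover items, with probability at least $$1-o(1)-C\cdot\frac{q^2r^3\log^3 m}{n}.$$ -/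

import Mathlib

open Filter Topology MeasureTheory Asymptotics

namespace FairDivision

/-- A family of bundles: agent `i` holds the set of items `M i`. Agents are `Fin n`, items are
`Fin m` (numbered from zero). -/
abbrev Bundles (n m : ℕ) : Type := Fin n → Finset (Fin m)

/-- A utility profile: `u i j` is the utility of agent `i` for the single item `j`. -/
abbrev Utilities (n m : ℕ) : Type := Fin n → Fin m → ℝ

/-- Additive utility of agent `i` for a set of items. -/
def bundleValue {n m : ℕ} (u : Utilities n m) (i : Fin n) (S : Finset (Fin m)) : ℝ :=
  ∑ j ∈ S, u i j

/-- The bundles partition the items: every item is given to exactly one agent. -/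
def IsAllocation {n m : ℕ} (M : Bundles n m) : Prop :=
  ∀ j : Fin m, ∃! i : Fin n, j ∈ M i

/-- Envy-freeness. -/
def IsEnvyFree {n m : ℕ} (u : Utilities n m) (M : Bundles n m) : Prop :=
  ∀ i i' : Fin n, bundleValue u i (M i') ≤ bundleValue u i (M i)

/-- Envy-freeness up to any item. -/
def IsEFX {n m : ℕ} (u : Utilities n m) (M : Bundles n m) : Prop :=
  ∀ i i' : Fin n, ∀ j ∈ M i', bundleValue u i ((M i').erase j) ≤ bundleValue u i (M i)

/-- `D` is supported on `[0, 1]` and has a density there with values between the positive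
constants `α` and `β`. (Such a `D` is automatically non-atomic.) -/
def IsPDFBounded (α β : ℝ) (D : Measure ℝ) : Prop :=
  0 < α ∧ 0 < β ∧ ∃ f : ℝ → ℝ, Measurable f ∧ (∀ x ∈ Set.Icc (0 : ℝ) 1, α ≤ f x ∧ f x ≤ β) ∧
    D = (volume.restrict (Set.Icc (0 : ℝ) 1)).withDensity (fun x => ENNReal.ofReal (f x))

/-- The law of a random utility profile: all `u i j` are drawn independently from `D`. -/
noncomputable def utilityLaw (D : Measure ℝ) (n m : ℕ) : Measure (Utilities n m) :=
  Measure.pi fun _ : Fin n => Measure.pi fun _ : Fin m => D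

/-- A deterministic allocation procedure: given the number of agents, the number of items and the
utilities, it returns a family of bundles (which may fail to be an allocation when the procedure
is unsuccessful). Its output has to depend measurably on the utilities. -/
structure AllocationAlgorithm where
  /-- The output for `n` agents, `m` items and the given utilities. -/
  run : (n m : ℕ) → Utilities n m → Bundles n m
  /-- Every possible output is returned on a measurable set of utility profiles. -/
  measurableSet_run_eq : ∀ (n m : ℕ) (M : Bundles n m), MeasurableSet {u | run n m u = M}

/-- The bundles form an envy-free allocation, they all have the same size, and every agent values
each item in her bundle at least `1 - C * log m / n`. -/
def IsGoodEnvyFree (C : ℝ) {n m : ℕ} (u : Utilities n m) (M : Bundles n m) : Prop :=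
  IsAllocation M ∧ IsEnvyFree u M ∧ (∀ i i' : Fin n, (M i).card = (M i').card) ∧
    ∀ i : Fin n, ∀ j ∈ M i, 1 - C * (Real.logb 2 m / n) ≤ u i j

/-- The specification of the envy-free algorithm: whenever the number `m n` of items is
divisible by the number `n` of agents and `2 n ≤ m n ≤ 2 ^ o(n)`, then with high probability, as
`n → ∞`, the output is a balanced envy-free allocation in which all the items are
valued at least `1 - C * log (m n) / n` by their owners. -/
def HasEnvyFreeGuarantee (D : Measure ℝ) (C : ℝ) (A : AllocationAlgorithm) : Prop :=
  ∀ m : ℕ → ℕ, (∀ᶠ n in atTop, n ∣ m n) → (∀ᶠ n in atTop, 2 * n ≤ m n) →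
    ((fun n : ℕ => Real.logb 2 (m n)) =o[atTop] fun n : ℕ => (n : ℝ)) →
    Tendsto (fun n : ℕ => (utilityLaw D n (m n)).real {u | IsGoodEnvyFree C u (A.run n (m n) u)})
      atTop (𝓝 1)

/-- The EFX algorithm, for `r = m / n` and `q = m % n`. Run `A` on the first `r * n` items; then
each of the last `q` agents gets one of the `q` leftover items. The leftover items are handed out
in an arbitrary manner, which is encoded by the permutation `σ`: the agent with index
`n - q + k` gets the item with index `r * n + σ k`. -/
def efxViaEF (A : AllocationAlgorithm) (n m : ℕ) (σ : Equiv.Perm (Fin (m % n)))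
    (u : Utilities n m) : Bundles n m := fun i =>
  (A.run n (m / n * n) (fun a j => u a (j.castLE (Nat.div_mul_le_self m n))) i).map
      (Fin.castLEEmb (Nat.div_mul_le_self m n)) ∪
    if h : n - m % n ≤ (i : ℕ) then
      {⟨m / n * n + σ ⟨(i : ℕ) - (n - m % n), by
          have := i.isLt
          have := Nat.mod_lt m (show 0 < n by omega)
          omega⟩, by
        have h₁ := Nat.div_add_mod' m n
        have h₂ := (σ ⟨(i : ℕ) - (n - m % n), by
          have := i.isLt
          have := Nat.mod_lt m (show 0 < n by omega)
          omega⟩).isLt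
        omega⟩}
    else ∅

end FairDivision

namespace FairDivision

open ProbabilityTheory
open scoped ENNReal

/-! ### Independent cells -/

/-! The subroutine can be an exhaustive search, so its guarantee reduces to showing that a good
allocation exists with high probability. Put `τ = (24 / α) * log m / n`, split the `r * n` items
into `r` blocks of `n`, and match each block perfectly to the agents using only values at least `1 -
τ`. Such matchings exist by Hall's theorem and a Chernoff bound (`exists_sparse_rectangle`,
`cellLaw_sparse_rectangle`), even when a prescribed partial matching has to be avoided. It remains
to remove envy.

For `r ≥ 3`, choose a uniformly random perfect matching in every block. By symmetry between the
agents, an exponential moment shows that the expected number of envious pairs is at most `n ^ 2 * (2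
* e * β * τ) ^ r`, which tends to zero (`lintegral_matchingAverage_le`,
`exists_matchings_of_sum_lt_one`). For `r = 2` this bound is only polylogarithmic. There, envy of
`i` towards `i'` creates a four-cycle in the graph of values at least `1 - 2 * τ`. With high
probability distinct four-cycles are disjoint, so selecting one of the two perfect matchings of each
cycle gives a partial matching. Avoiding it breaks all the cycles (`SelectedEdge.right_unique`,
`HasGoodMatchings.of_two`).

For EFX, every agent owns `r` items of value at least `1 - δ`, where `δ` is of order `log m / n`. If
she envies a bundle that received a leftover item and then lost another item, each of the `r`
remaining items is worth at least `1 - r * δ` to her; since `r ≥ 2`, these include an original item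
as well as the leftover one (`isEFX_efxViaEF`). A bundle interests only `O(r ^ 2 * log m)` agents
through its original items, because no item is popular with too many agents. The leftover columns
are independent of the subroutine's input, so each such agent likes some leftover item with
probability `O(q * r * log m / n)`. Summing over the `q` receivers gives `O(q ^ 2 * r ^ 3 * log ^ 2
m / n)` (`utilityLaw_nearEnvy`, `utilityLaw_not_efx_le`). -/

/-- The law of a matrix with independent entries of law `D`. -/
noncomputable def cellLaw (D : Measure ℝ) (I J : Type*) [Fintype I] [Fintype J] :
    Measure (I → J → ℝ) :=
  Measure.pi fun _ : I => Measure.pi fun _ : J => D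

section CellLaw

lemma measurable_cells {I J Ω : Type*} [MeasurableSpace Ω] {X : Ω → I → J → ℝ}
    (h : ∀ i j, Measurable fun ω => X ω i j) : Measurable X :=
  measurable_pi_lambda _ fun i => measurable_pi_lambda _ fun j => h i j

lemma measurable_cell {I J : Type*} (i : I) (j : J) : Measurable fun u : I → J → ℝ => u i j :=
  (measurable_pi_apply j).comp (measurable_pi_apply i)

variable {D : Measure ℝ} [IsProbabilityMeasure D]
variable {I J : Type*} [Fintype I] [Fintype J]

instance : IsProbabilityMeasure (cellLaw D I J) := by
  unfold cellLaw; infer_instance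

lemma lintegral_pi_prod {ι Ω : Type*} [Fintype ι] [MeasurableSpace Ω] (μ : ι → Measure Ω)
    [∀ i, IsProbabilityMeasure (μ i)] (g : ι → Ω → ℝ≥0∞) (hg : ∀ i, Measurable (g i)) :
    ∫⁻ x, ∏ i, g i (x i) ∂Measure.pi μ = ∏ i, ∫⁻ y, g i y ∂μ i := by
  refine (lintegral_prod_eq_prod_lintegral_of_indepFun Finset.univ
    (fun i (x : ι → Ω) => g i (x i)) (iIndepFun_pi fun i => (hg i).aemeasurable)
    fun i => (hg i).comp (measurable_pi_apply i)).trans ?_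
  exact Finset.prod_congr rfl fun i _ => (measurePreserving_eval μ i).lintegral_comp (hg i)

lemma lintegral_cellLaw_prod (g : I → J → ℝ → ℝ≥0∞) (hg : ∀ i j, Measurable (g i j)) :
    ∫⁻ u, ∏ i, ∏ j, g i j (u i j) ∂cellLaw D I J = ∏ i, ∏ j, ∫⁻ x, g i j x ∂D := by
  have hm : ∀ i, Measurable fun v : J → ℝ => ∏ j, g i j (v j) := fun i =>
    Finset.measurable_prod _ fun j _ => (hg i j).comp (measurable_pi_apply j)
  unfold cellLaw
  refine (lintegral_pi_prod _ (fun i (v : J → ℝ) => ∏ j, g i j (v j)) hm).trans ?_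
  exact Finset.prod_congr rfl fun i _ => lintegral_pi_prod _ _ (hg i)

lemma cellLaw_box (s : I → J → Set ℝ) :
    cellLaw D I J {u | ∀ i j, u i j ∈ s i j} = ∏ i, ∏ j, D (s i j) := by
  have : {u : I → J → ℝ | ∀ i j, u i j ∈ s i j} =
      Set.univ.pi fun i => Set.univ.pi fun j => s i j := by
    ext u; simp [Set.mem_pi]
  rw [this, cellLaw, Measure.pi_pi]
  simp only [Measure.pi_pi]

lemma measurableSet_box {s : I → J → Set ℝ} (hs : ∀ i j, MeasurableSet (s i j)) :
    MeasurableSet {u : I → J → ℝ | ∀ i j, u i j ∈ s i j} := by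
  have : {u : I → J → ℝ | ∀ i j, u i j ∈ s i j} =
      Set.univ.pi fun i => Set.univ.pi fun j => s i j := by
    ext u; simp [Set.mem_pi]
  rw [this]
  exact MeasurableSet.univ_pi fun i => MeasurableSet.univ_pi fun j => hs i j

/-- The law of a matrix with independent entries is determined by its values on boxes. -/
lemma eq_cellLaw {ν : Measure (I → J → ℝ)}
    (h : ∀ s : I → J → Set ℝ, (∀ i j, MeasurableSet (s i j)) →
      ν {u | ∀ i j, u i j ∈ s i j} = ∏ i, ∏ j, D (s i j)) : ν = cellLaw D I J := by
  symm
  unfold cellLaw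
  -- The law is a product of products, so equality is tested on the π-system of products over rows
  -- of boxes within a row.
  refine Measure.pi_eq_generateFrom
    (C := fun _ : I => Set.univ.pi '' Set.univ.pi fun _ : J => {s : Set ℝ | MeasurableSet s})
    (fun _ => generateFrom_pi) (fun _ => isPiSystem_pi) (fun _ => ?_) ?_
  · refine ⟨fun _ => Set.univ, fun _ => ⟨fun _ => Set.univ, fun _ _ => MeasurableSet.univ (α := ℝ), ?_⟩,
      fun _ => measure_lt_top _ _, Set.iUnion_const _⟩
    simp
  · intro s hs
    choose t ht hts using hs
    have := h t fun i j => ht i j trivial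
    have e : {u : I → J → ℝ | ∀ i j, u i j ∈ t i j} = Set.univ.pi s := by
      ext u
      simp [← hts, Set.mem_pi]
    rw [← e, this]
    refine Finset.prod_congr rfl fun i _ => ?_
    rw [← hts, Measure.pi_pi]

lemma measurePreserving_of_box {Ω : Type*} [MeasurableSpace Ω] {μ : Measure Ω}
    {X : Ω → I → J → ℝ} (hX : Measurable X)
    (h : ∀ s : I → J → Set ℝ, (∀ i j, MeasurableSet (s i j)) →
      μ {ω | ∀ i j, X ω i j ∈ s i j} = ∏ i, ∏ j, D (s i j)) :
    MeasurePreserving X μ (cellLaw D I J) := by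
  refine ⟨hX, eq_cellLaw fun s hs => ?_⟩
  rw [Measure.map_apply hX (measurableSet_box hs)]
  exact h s hs

/-- Permuting the rows preserves the law. -/
lemma measurePreserving_rows (σ : Equiv.Perm I) :
    MeasurePreserving (fun (u : I → J → ℝ) i j => u (σ i) j) (cellLaw D I J) (cellLaw D I J) := by
  refine measurePreserving_of_box (measurable_cells fun i j => measurable_cell _ _) fun s hs => ?_
  rw [← Equiv.prod_comp σ.symm fun i => ∏ j, D (s i j), ← cellLaw_box]
  congr 1
  ext u
  simp only [Set.mem_ofPred_eq]
  exact ⟨fun h i j => by simpa using h (σ.symm i) j, fun h i j => by simpa using h (σ i) j⟩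

/-- Restricting to some of the columns. -/
lemma measurePreserving_columns {K : Type*} [Fintype K] {e : K → J} (he : e.Injective) :
    MeasurePreserving (fun (u : I → J → ℝ) i k => u i (e k)) (cellLaw D I J) (cellLaw D I K) := by
  classical
  refine measurePreserving_of_box (measurable_cells fun i j => measurable_cell _ _) fun s hs => ?_
  -- By injectivity each intersection runs over at most one `k`; a column outside the range of `e`
  -- is unconstrained.
  have := cellLaw_box (D := D) fun (i : I) (j : J) => ⋂ k ∈ {k | e k = j}, s i k
  have e1 : {u : I → J → ℝ | ∀ i k, u i (e k) ∈ s i k} =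
      {u | ∀ i j, u i j ∈ ⋂ k ∈ {k | e k = j}, s i k} := by
    ext u
    simp only [Set.mem_ofPred_eq, Set.mem_iInter]
    exact ⟨fun h i j k hk => hk ▸ h i k, fun h i k => h i (e k) k rfl⟩
  rw [e1, this]
  refine Finset.prod_congr rfl fun i _ => ?_
  rw [← Finset.prod_subset (Finset.subset_univ (Finset.univ.image e)),
    Finset.prod_image he.injOn]
  · refine Finset.prod_congr rfl fun k _ => ?_
    congr 1
    ext x
    simp only [Set.mem_ofPred_eq, Set.mem_iInter]
    exact ⟨fun h => h k rfl, fun h k' hk => he hk ▸ h⟩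
  · intro j _ hj
    have : (⋂ k ∈ {k | e k = j}, s i k) = Set.univ := by
      ext x
      simp only [Set.mem_ofPred_eq, Set.mem_iInter, Set.mem_univ, iff_true]
      rintro k rfl
      simp at hj
    rw [this, measure_univ]

/-- A matrix is assembled from independent matrices with disjoint sets of columns. -/
lemma measurePreserving_blocks {K L : Type*} [Fintype K] [Fintype L] (e : J ≃ L × K) :
    MeasurePreserving (fun (v : L → I → K → ℝ) i j => v (e j).1 i (e j).2)
      (Measure.pi fun _ : L => cellLaw D I K) (cellLaw D I J) := by
  refine measurePreserving_of_box
    (measurable_cells fun i j => (measurable_cell _ _).comp (measurable_pi_apply _)) fun s hs => ?_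
  have e1 : {v : L → I → K → ℝ | ∀ i j, v (e j).1 i (e j).2 ∈ s i j} =
      Set.univ.pi fun l => {w | ∀ i k, w i k ∈ s i (e.symm (l, k))} := by
    ext v
    simp only [Set.mem_ofPred_eq, Set.mem_pi, Set.mem_univ, true_implies]
    exact ⟨fun h l i k => by simpa using h i (e.symm (l, k)),
      fun h i j => by simpa using h (e j).1 i (e j).2⟩
  rw [e1, Measure.pi_pi]
  simp only [cellLaw_box]
  rw [Finset.prod_comm]
  refine Finset.prod_congr rfl fun i _ => ?_
  rw [← Equiv.prod_comp e.symm, Fintype.prod_prod_type]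

/-- A matrix is assembled from two independent matrices with disjoint sets of columns. -/
lemma measurePreserving_glue {K L : Type*} [Fintype K] [Fintype L] (e : J ≃ K ⊕ L) :
    MeasurePreserving (fun (v : (I → K → ℝ) × (I → L → ℝ)) i j => Sum.elim (v.1 i) (v.2 i) (e j))
      ((cellLaw D I K).prod (cellLaw D I L)) (cellLaw D I J) := by
  refine measurePreserving_of_box (measurable_cells fun i j => ?_) fun s hs => ?_
  · cases e j with
    | inl k => exact (measurable_cell _ _).comp measurable_fst
    | inr k => exact (measurable_cell _ _).comp measurable_snd
  have e1 : {v : (I → K → ℝ) × (I → L → ℝ) | ∀ i j, Sum.elim (v.1 i) (v.2 i) (e j) ∈ s i j} =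
      {w | ∀ i k, w i k ∈ s i (e.symm (.inl k))} ×ˢ {w | ∀ i k, w i k ∈ s i (e.symm (.inr k))} := by
    ext v
    simp only [Set.mem_ofPred_eq, Set.mem_prod]
    refine ⟨fun h => ⟨fun i k => by simpa using h i (e.symm (.inl k)),
      fun i k => by simpa using h i (e.symm (.inr k))⟩, fun h i j => ?_⟩
    rcases hj : e j with k | k
    · have := h.1 i k
      rwa [← hj, Equiv.symm_apply_apply] at this
    · have := h.2 i k
      rwa [← hj, Equiv.symm_apply_apply] at this
  rw [e1, Measure.prod_prod, cellLaw_box, cellLaw_box, ← Finset.prod_mul_distrib]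
  refine Finset.prod_congr rfl fun i _ => ?_
  rw [← Equiv.prod_comp e.symm, Fintype.prod_sum_type]

end CellLaw

/-! ### Bounded densities -/

section Density

variable {α β : ℝ} {D : Measure ℝ}

lemma IsPDFBounded.lintegral_le (h : IsPDFBounded α β D) {g : ℝ → ℝ≥0∞} (hg : Measurable g) :
    ∫⁻ x, g x ∂D ≤ ENNReal.ofReal β * ∫⁻ x in Set.Icc (0 : ℝ) 1, g x := by
  obtain ⟨-, -, f, hf, hb, rfl⟩ := h
  rw [lintegral_withDensity_eq_lintegral_mul _ hf.ennreal_ofReal hg, ← lintegral_const_mul _ hg]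
  refine setLIntegral_mono (hg.const_mul _) fun x hx => ?_
  exact mul_le_mul_left (ENNReal.ofReal_le_ofReal (hb x hx).2) _

lemma IsPDFBounded.le_apply_Ici (h : IsPDFBounded α β D) {y : ℝ} (hy : y ≤ 1) :
    ENNReal.ofReal (α * y) ≤ D (Set.Ici (1 - y)) := by
  obtain ⟨ha, -, f, hf, hb, rfl⟩ := h
  rw [withDensity_apply _ measurableSet_Ici, Measure.restrict_restrict measurableSet_Ici]
  have : Set.Ici (1 - y) ∩ Set.Icc (0 : ℝ) 1 = Set.Icc (1 - y) 1 := by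
    ext x; simp only [Set.mem_inter_iff, Set.mem_Ici, Set.mem_Icc]; constructor
    · rintro ⟨h1, h2, h3⟩; exact ⟨h1, h3⟩
    · rintro ⟨h1, h3⟩; exact ⟨h1, by linarith, h3⟩
  rw [this]
  calc ENNReal.ofReal (α * y) = ∫⁻ _ in Set.Icc (1 - y) 1, ENNReal.ofReal α := by
        rw [setLIntegral_const, Real.volume_Icc, ENNReal.ofReal_mul ha.le]; congr 2; ring
    _ ≤ _ := setLIntegral_mono hf.ennreal_ofReal fun x hx =>
        ENNReal.ofReal_le_ofReal (hb x ⟨by linarith [hx.1], hx.2⟩).1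

lemma IsPDFBounded.apply_Ici_le (h : IsPDFBounded α β D) (y : ℝ) :
    D (Set.Ici (1 - y)) ≤ ENNReal.ofReal (β * y) := by
  have := h.lintegral_le (g := (Set.Ici (1 - y)).indicator 1)
    (measurable_one.indicator measurableSet_Ici)
  rw [lintegral_indicator_one measurableSet_Ici, lintegral_indicator_one measurableSet_Ici,
    Measure.restrict_apply measurableSet_Ici] at this
  refine this.trans ?_
  rw [ENNReal.ofReal_mul h.2.1.le]
  gcongr
  refine (measure_mono (t := Set.Icc (1 - y) 1) fun x hx => ⟨hx.1, hx.2.2⟩).trans ?_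
  rw [Real.volume_Icc]
  exact ENNReal.ofReal_le_ofReal (by linarith)

lemma IsPDFBounded.ae_mem (h : IsPDFBounded α β D) : D (Set.Icc (0 : ℝ) 1)ᶜ = 0 := by
  obtain ⟨ha, -, f, hf, hb, rfl⟩ := h
  rw [withDensity_apply _ measurableSet_Icc.compl,
    Measure.restrict_restrict measurableSet_Icc.compl]
  simp

lemma IsPDFBounded.lintegral_exp_le (h : IsPDFBounded α β D) {t : ℝ} (ht : 0 < t) :
    ∫⁻ x, ENNReal.ofReal (Real.exp (-(t * (1 - x)))) ∂D ≤ ENNReal.ofReal (β / t) := by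
  refine (h.lintegral_le (by fun_prop)).trans ?_
  rw [div_eq_mul_inv, ENNReal.ofReal_mul h.2.1.le]
  gcongr
  rw [← ofReal_integral_eq_lintegral_ofReal]
  · apply ENNReal.ofReal_le_ofReal
    rw [integral_Icc_eq_integral_Ioc, ← intervalIntegral.integral_of_le zero_le_one]
    have hd : ∀ x ∈ Set.uIcc (0 : ℝ) 1, HasDerivAt
        (fun x => t⁻¹ * Real.exp (-(t * (1 - x)))) (Real.exp (-(t * (1 - x)))) x := by
      intro x _
      have h1 : HasDerivAt (fun x : ℝ => -(t * (1 - x))) t x := by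
        simpa using! (((hasDerivAt_id x).const_sub 1).const_mul t).neg
      convert! (h1.exp).const_mul t⁻¹ using 1
      rw [mul_left_comm, inv_mul_cancel₀ ht.ne', mul_one]
    rw [intervalIntegral.integral_eq_sub_of_hasDerivAt hd
      (Continuous.intervalIntegrable (by fun_prop) _ _)]
    have := Real.exp_pos (-(t * (1 - 0)))
    have h2 : (0 : ℝ) < t⁻¹ := by positivity
    simp only [sub_self, mul_zero, neg_zero, Real.exp_zero, mul_one]
    nlinarith [mul_pos h2 this]
  · exact (Continuous.integrableOn_Icc (by fun_prop))
  · exact Filter.Eventually.of_forall fun x => (Real.exp_pos _).le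

lemma cellLaw_unit [IsProbabilityMeasure D] (h : IsPDFBounded α β D) (I J : Type*) [Fintype I]
    [Fintype J] : cellLaw D I J {u | ∀ i j, u i j ∈ Set.Icc (0 : ℝ) 1}ᶜ = 0 := by
  have h1 : D (Set.Icc (0 : ℝ) 1) = 1 := by
    rw [prob_compl_eq_zero_iff measurableSet_Icc |>.symm]
    exact h.ae_mem
  rw [prob_compl_eq_zero_iff (measurableSet_box fun _ _ => measurableSet_Icc), cellLaw_box]
  simp [h1]

end Density

/-! ### Moments of the number of cells with a large entry -/

section Moments

variable {D : Measure ℝ} [IsProbabilityMeasure D]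
variable {I J : Type*} [Fintype I] [Fintype J]

lemma lintegral_ite_one {A : Set ℝ} (hA : MeasurableSet A) [DecidablePred (· ∈ A)] {c : ℝ}
    (hc : 0 ≤ c) :
    ∫⁻ x, (if x ∈ A then ENNReal.ofReal c else 1) ∂D = ENNReal.ofReal (1 + (c - 1) * D.real A) := by
  have h1 : D.real A ≤ 1 := measureReal_le_one
  have h0 : 0 ≤ D.real A := measureReal_nonneg
  have e1 : ∫⁻ x in A, (if x ∈ A then ENNReal.ofReal c else 1) ∂D = ENNReal.ofReal c * D A := by
    rw [setLIntegral_congr_fun (g := fun _ => ENNReal.ofReal c) hA fun x hx => if_pos hx,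
      setLIntegral_const]
  have e2 : ∫⁻ x in Aᶜ, (if x ∈ A then ENNReal.ofReal c else 1) ∂D = D Aᶜ := by
    rw [setLIntegral_congr_fun (g := fun _ => 1) hA.compl fun x hx => if_neg hx,
      setLIntegral_const, one_mul]
  rw [← lintegral_add_compl _ hA, e1, e2, ← ofReal_measureReal (s := A),
    ← ofReal_measureReal (s := Aᶜ), probReal_compl_eq_one_sub hA, ← ENNReal.ofReal_mul hc,
    ← ENNReal.ofReal_add (by positivity) (by linarith)]
  congr 1; ring

open Classical in
-- The moment generating function of a binomial variable, with `c` in the role of the exponential.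
-- Both Chernoff bounds below are Markov's inequality applied to it, with `c = exp (-1)` and `c =
-- exp 1`.
lemma lintegral_pow_card {A : Set ℝ} (hA : MeasurableSet A) (E : Finset (I × J)) {c : ℝ}
    (hc : 0 ≤ c) :
    ∫⁻ u, ENNReal.ofReal c ^ (E.filter fun x => u x.1 x.2 ∈ A).card ∂cellLaw D I J =
      ENNReal.ofReal (1 + (c - 1) * D.real A) ^ E.card := by
  set g : I → J → ℝ → ℝ≥0∞ := fun i j x =>
    if (i, j) ∈ E then (if x ∈ A then ENNReal.ofReal c else 1) else 1 with hg
  have hgm : ∀ i j, Measurable (g i j) := fun i j => by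
    simp only [hg]
    split_ifs
    · exact Measurable.ite hA measurable_const measurable_const
    · exact measurable_const
  have e1 : ∀ u : I → J → ℝ, ENNReal.ofReal c ^ (E.filter fun x => u x.1 x.2 ∈ A).card =
      ∏ i, ∏ j, g i j (u i j) := by
    intro u
    rw [← Fintype.prod_prod_type' fun i j => g i j (u i j)]
    simp only [hg]
    rw [← Finset.prod_filter, Finset.filter_mem_eq_inter, Finset.univ_inter,
      ← Finset.prod_filter, Finset.prod_const]
  simp only [e1]
  rw [lintegral_cellLaw_prod _ hgm, ← Fintype.prod_prod_type' fun i j => ∫⁻ x, g i j x ∂D,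
    ← Finset.prod_const, ← Finset.prod_subset (Finset.subset_univ E)]
  · refine Finset.prod_congr rfl fun x hx => ?_
    rw [← lintegral_ite_one hA hc]
    simp [hg, hx]
  · intro x _ hx
    simp [hg, hx]

open Classical in
/-- First moment bound: all the entries in `E` are large. -/
lemma cellLaw_forall_mem (A : Set ℝ) (E : Finset (I × J)) :
    cellLaw D I J {u | ∀ x ∈ E, u x.1 x.2 ∈ A} = D A ^ E.card := by
  have := cellLaw_box (D := D) fun (i : I) (j : J) => if (i, j) ∈ E then A else Set.univ
  have e1 : {u : I → J → ℝ | ∀ x ∈ E, u x.1 x.2 ∈ A} =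
      {u | ∀ i j, u i j ∈ if (i, j) ∈ E then A else Set.univ} := by
    ext u
    simp only [Set.mem_ofPred_eq, Prod.forall]
    refine forall_congr' fun i => forall_congr' fun j => ?_
    split_ifs with h <;> simp [h]
  rw [e1, this, ← Fintype.prod_prod_type' fun i j => D (if (i, j) ∈ E then A else Set.univ),
    ← Finset.prod_const, ← Finset.prod_subset (Finset.subset_univ E)]
  · exact Finset.prod_congr rfl fun x hx => by simp [hx]
  · intro x _ hx
    simp [hx]

lemma measure_le_lintegral_of_one_le {Ω : Type*} [MeasurableSpace Ω] {μ : Measure Ω} {s : Set Ω}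
    (f : Ω → ℝ≥0∞) (hf : Measurable f) (h : ∀ x ∈ s, 1 ≤ f x) : μ s ≤ ∫⁻ x, f x ∂μ := by
  have := mul_meas_ge_le_lintegral (μ := μ) hf 1
  rw [one_mul] at this
  exact (measure_mono h).trans this

open Classical in
lemma measurable_card_filter {I J : Type*} {A : Set ℝ} (hA : MeasurableSet A) (E : Finset (I × J)) :
    Measurable fun u : I → J → ℝ => (E.filter fun x => u x.1 x.2 ∈ A).card := by
  simp only [Finset.card_filter]
  exact Finset.measurable_sum _ fun x _ =>
    Measurable.ite (measurable_cell x.1 x.2 hA) measurable_const measurable_const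

open Classical in
/-- Chernoff's bound for the lower tail. -/
lemma cellLaw_card_le {A : Set ℝ} (hA : MeasurableSet A) (E : Finset (I × J)) {p : ℝ}
    (hp : p ≤ D.real A) (k : ℕ) :
    cellLaw D I J {u | (E.filter fun x => u x.1 x.2 ∈ A).card ≤ k} ≤
      ENNReal.ofReal (Real.exp (k - p * E.card / 2)) := by
  have h0 := Real.exp_pos (-1)
  have hc : Real.exp (-1) ≤ 1 / 2 := by
    rw [Real.exp_neg, one_div]
    exact inv_anti₀ two_pos (by linarith [Real.add_one_le_exp 1])
  have key := lintegral_pow_card (D := D) hA E h0.le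
  calc _ ≤ ∫⁻ u, ENNReal.ofReal (Real.exp k) *
          ENNReal.ofReal (Real.exp (-1)) ^ (E.filter fun x => u x.1 x.2 ∈ A).card
          ∂cellLaw D I J := by
        refine measure_le_lintegral_of_one_le _ ?_ fun u hu => ?_
        · exact ((measurable_of_countable fun k : ℕ =>
            ENNReal.ofReal (Real.exp (-1)) ^ k).comp (measurable_card_filter hA E)).const_mul _
        · rw [← ENNReal.ofReal_pow h0.le, ← ENNReal.ofReal_mul (Real.exp_pos _).le,
            ENNReal.one_le_ofReal, ← Real.exp_nat_mul, ← Real.exp_add, Real.one_le_exp_iff]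
          have : ((E.filter fun x => u x.1 x.2 ∈ A).card : ℝ) ≤ k := by exact_mod_cast hu
          linarith
    _ = ENNReal.ofReal (Real.exp k) *
          ENNReal.ofReal (1 + (Real.exp (-1) - 1) * D.real A) ^ E.card := by
        rw [lintegral_const_mul', key]
        exact ENNReal.ofReal_ne_top
    _ ≤ ENNReal.ofReal (Real.exp k) * ENNReal.ofReal (Real.exp (-(p / 2))) ^ E.card := by
        gcongr
        have := Real.add_one_le_exp (-(p / 2))
        have h1 : 0 ≤ D.real A := measureReal_nonneg
        nlinarith
    _ = _ := by
        rw [← ENNReal.ofReal_pow (Real.exp_pos _).le, ← ENNReal.ofReal_mul (Real.exp_pos _).le,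
          ← Real.exp_nat_mul, ← Real.exp_add]
        congr 2; ring

open Classical in
/-- Chernoff's bound for the upper tail. -/
lemma cellLaw_le_card {A : Set ℝ} (hA : MeasurableSet A) (E : Finset (I × J)) {p : ℝ}
    (hp : D.real A ≤ p) (d : ℝ) :
    cellLaw D I J {u | d ≤ (E.filter fun x => u x.1 x.2 ∈ A).card} ≤
      ENNReal.ofReal (Real.exp (2 * p * E.card - d)) := by
  have h0 := Real.exp_pos 1
  have key := lintegral_pow_card (D := D) hA E h0.le
  calc _ ≤ ∫⁻ u, ENNReal.ofReal (Real.exp (-d)) *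
          ENNReal.ofReal (Real.exp 1) ^ (E.filter fun x => u x.1 x.2 ∈ A).card
          ∂cellLaw D I J := by
        refine measure_le_lintegral_of_one_le _ ?_ fun u hu => ?_
        · exact ((measurable_of_countable fun k : ℕ =>
            ENNReal.ofReal (Real.exp 1) ^ k).comp (measurable_card_filter hA E)).const_mul _
        · rw [← ENNReal.ofReal_pow h0.le, ← ENNReal.ofReal_mul (Real.exp_pos _).le,
            ENNReal.one_le_ofReal, ← Real.exp_nat_mul, ← Real.exp_add, Real.one_le_exp_iff]
          have : d ≤ ((E.filter fun x => u x.1 x.2 ∈ A).card : ℝ) := hu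
          linarith
    _ = ENNReal.ofReal (Real.exp (-d)) *
          ENNReal.ofReal (1 + (Real.exp 1 - 1) * D.real A) ^ E.card := by
        rw [lintegral_const_mul', key]
        exact ENNReal.ofReal_ne_top
    _ ≤ ENNReal.ofReal (Real.exp (-d)) * ENNReal.ofReal (Real.exp (2 * p)) ^ E.card := by
        gcongr
        have := Real.add_one_le_exp (2 * p)
        have h1 : 0 ≤ D.real A := measureReal_nonneg
        nlinarith [Real.exp_one_lt_d9]
    _ = _ := by
        rw [← ENNReal.ofReal_pow (Real.exp_pos _).le, ← ENNReal.ofReal_mul (Real.exp_pos _).le,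
          ← Real.exp_nat_mul, ← Real.exp_add]
        congr 2; ring

end Moments

/-! ### Perfect matchings in random bipartite graphs -/

open Classical in
/-- If the bipartite graph `G` has no perfect matching avoiding the partial matching `R`, then
some large rectangle has few edges of `G`. -/
lemma exists_sparse_rectangle {n : ℕ} {G R : Fin n → Fin n → Prop}
    (hrow : ∀ i j j', R i j → R i j' → j = j') (hcol : ∀ i i' j, R i j → R i' j → i = i')
    (h : ¬ ∃ π : Equiv.Perm (Fin n), ∀ i, G i (π i) ∧ ¬ R i (π i)) :
    ∃ S T : Finset (Fin n), S.card + T.card = n + 1 ∧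
      ((S ×ˢ T).filter fun x => G x.1 x.2).card ≤ min S.card T.card := by
  have hall := Fintype.all_card_le_filter_rel_iff_exists_injective
    fun i j : Fin n => G i j ∧ ¬ R i j
  have : ¬ ∀ A : Finset (Fin n),
      A.card ≤ (Finset.univ.filter fun b => ∃ a ∈ A, G a b ∧ ¬ R a b).card := by
    intro hA
    obtain ⟨f, hf, hfG⟩ := hall.1 fun A => by convert hA A
    exact h ⟨Equiv.ofBijective f (Finite.injective_iff_bijective.1 hf), hfG⟩
  push Not at this
  obtain ⟨S, hS⟩ := this
  set N := Finset.univ.filter fun b => ∃ a ∈ S, G a b ∧ ¬ R a b with hN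
  -- Hall's condition fails for `S`, so at least `n + 1 - |S|` columns lie outside its
  -- neighbourhood. All `G`-edges from `S` to those columns belong to the partial matching `R`,
  -- which has at most one edge in each row and column.
  have hNc : Nᶜ.card = n - N.card := by rw [Finset.card_compl, Fintype.card_fin]
  have hNn : N.card ≤ n := by simpa using Finset.card_le_univ N
  have hSn : S.card ≤ n := by simpa using Finset.card_le_univ S
  obtain ⟨T, hT, hTc⟩ := Finset.exists_subset_card_eq (s := Nᶜ) (n := n + 1 - S.card) (by omega)
  refine ⟨S, T, by omega, ?_⟩
  have hR : ∀ x ∈ (S ×ˢ T).filter fun x => G x.1 x.2, R x.1 x.2 := by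
    rintro ⟨i, j⟩ hx
    simp only [Finset.mem_filter, Finset.mem_product] at hx
    by_contra hR
    have := hT hx.1.2
    simp only [hN, Finset.mem_compl, Finset.mem_filter, Finset.mem_univ, true_and] at this
    exact this ⟨i, hx.1.1, hx.2, hR⟩
  refine le_min ?_ ?_
  · refine Finset.card_le_card_of_injOn Prod.fst (fun x hx => ?_) fun x hx y hy hxy => ?_
    · have := (Finset.mem_filter.1 hx).1
      exact (Finset.mem_product.1 this).1
    · exact Prod.ext hxy (hrow _ _ _ (hR x hx) (hxy ▸ hR y hy))
  · refine Finset.card_le_card_of_injOn Prod.snd (fun x hx => ?_) fun x hx y hy hxy => ?_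
    · have := (Finset.mem_filter.1 hx).1
      exact (Finset.mem_product.1 this).2
    · exact Prod.ext (hcol _ _ _ (hR x hx) (hxy ▸ hR y hy)) hxy

/-- By the symmetry of binomial coefficients, both factors can be written with a lower index at most
the minimum of `s` and `n + 1 - s`. -/
lemma choose_mul_choose_le {n s : ℕ} (hn : 1 ≤ n) (hs : 1 ≤ s) (hsn : s ≤ n) :
    n.choose s * n.choose (n + 1 - s) ≤ (n ^ 2) ^ min s (n + 1 - s) := by
  rcases le_total s (n + 1 - s) with h | h
  · rw [min_eq_left h, ← pow_mul, two_mul, pow_add]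
    refine Nat.mul_le_mul (Nat.choose_le_pow n s) ?_
    rw [← Nat.choose_symm (by omega)]
    exact (Nat.choose_le_pow n _).trans (Nat.pow_le_pow_right hn (by omega))
  · rw [min_eq_right h, ← pow_mul, two_mul, pow_add]
    refine Nat.mul_le_mul ?_ (Nat.choose_le_pow n _)
    rw [← Nat.choose_symm hsn]
    exact (Nat.choose_le_pow n _).trans (Nat.pow_le_pow_right hn (by omega))

open Classical in
/-- Random bipartite graphs of average degree `p * n` do not have large sparse rectangles. -/
lemma cellLaw_sparse_rectangle {D : Measure ℝ} [IsProbabilityMeasure D] {A : Set ℝ}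
    (hA : MeasurableSet A) {p : ℝ} (hp0 : 0 ≤ p) (hp : p ≤ D.real A) {n : ℕ} (hn : 1 ≤ n) :
    cellLaw D (Fin n) (Fin n) {u | ∃ S T : Finset (Fin n), S.card + T.card = n + 1 ∧
      ((S ×ˢ T).filter fun x => u x.1 x.2 ∈ A).card ≤ min S.card T.card} ≤
      ENNReal.ofReal ((n + 1) * n ^ 2 * Real.exp (1 - p * n / 4)) := by
  have hn' : (1 : ℝ) ≤ n := by exact_mod_cast hn
  set x := Real.exp (1 - p * n / 4) with hx
  have hx0 : 0 < x := Real.exp_pos _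
  -- If `n ^ 2 * x > 1`, the claimed bound exceeds one. Otherwise powers of `n ^ 2 * x` are at most
  -- `n ^ 2 * x` itself, so each size `s` contributes at most that.
  rcases lt_or_ge 1 ((n : ℝ) ^ 2 * x) with h1 | h1
  · refine prob_le_one.trans ?_
    rw [ENNReal.one_le_ofReal]
    nlinarith
  have hST : ∀ S T : Finset (Fin n), S.card + T.card = n + 1 →
      cellLaw D (Fin n) (Fin n)
        {u | ((S ×ˢ T).filter fun x => u x.1 x.2 ∈ A).card ≤ min S.card T.card} ≤
      ENNReal.ofReal (x ^ min S.card T.card) := by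
    intro S T hc
    refine (cellLaw_card_le hA (S ×ˢ T) hp _).trans (ENNReal.ofReal_le_ofReal ?_)
    rw [hx, ← Real.exp_nat_mul, Real.exp_le_exp, Finset.card_product]
    -- The larger side has at least `(n + 1) / 2` elements, so the rectangle has at least `min * n /
    -- 2` cells and Chernoff's exponent is at most `min * (1 - p * n / 4)`.
    have h2 : (min S.card T.card : ℕ) * n ≤ 2 * (S.card * T.card) := by
      rcases le_total S.card T.card with h | h
      · rw [min_eq_left h]; nlinarith
      · rw [min_eq_right h]; nlinarith
    have h3 : ((min S.card T.card : ℕ) : ℝ) * n ≤ 2 * (S.card * T.card) := by exact_mod_cast h2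
    push_cast at h3 ⊢
    nlinarith
  calc _ ≤ cellLaw D (Fin n) (Fin n) (⋃ S ∈ (Finset.univ : Finset (Fin n)).powerset,
          ⋃ T ∈ (Finset.univ : Finset (Fin n)).powersetCard (n + 1 - S.card),
          {u | ((S ×ˢ T).filter fun x => u x.1 x.2 ∈ A).card ≤ min S.card T.card}) := by
        refine measure_mono fun u hu => ?_
        obtain ⟨S, T, hc, h⟩ := hu
        simp only [Set.mem_iUnion]
        exact ⟨S, by simp, T, by simp [Finset.mem_powersetCard]; omega, h⟩
    _ ≤ ∑ S ∈ (Finset.univ : Finset (Fin n)).powerset,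
          ∑ T ∈ (Finset.univ : Finset (Fin n)).powersetCard (n + 1 - S.card),
            ENNReal.ofReal (x ^ min S.card (n + 1 - S.card)) := by
        refine (measure_biUnion_finset_le _ _).trans (Finset.sum_le_sum fun S _ => ?_)
        refine (measure_biUnion_finset_le _ _).trans (Finset.sum_le_sum fun T hT => ?_)
        have hT := (Finset.mem_powersetCard.1 hT).2
        have hS : S.card ≤ n := by simpa using Finset.card_le_univ S
        exact hT ▸ hST S T (by omega)
    _ = ∑ s ∈ Finset.range (n + 1), n.choose s •
          (n.choose (n + 1 - s) • ENNReal.ofReal (x ^ min s (n + 1 - s))) := by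
        simp only [Finset.sum_const, Finset.card_powersetCard, Finset.card_univ, Fintype.card_fin]
        rw [Finset.sum_powerset_apply_card fun s =>
          n.choose (n + 1 - s) • ENNReal.ofReal (x ^ min s (n + 1 - s))]
        simp
    _ ≤ ∑ s ∈ Finset.range (n + 1), ENNReal.ofReal (n ^ 2 * x) := by
        refine Finset.sum_le_sum fun s hs => ?_
        rw [← mul_smul, ← ENNReal.ofReal_nsmul]
        refine ENNReal.ofReal_le_ofReal ?_
        have hs := Finset.mem_range.1 hs
        rcases Nat.eq_zero_or_pos s with rfl | hs0
        · rw [Nat.sub_zero, Nat.choose_succ_self]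
          simp; positivity
        have := choose_mul_choose_le hn hs0 (by omega)
        rw [nsmul_eq_mul]
        calc _ ≤ (((n ^ 2) ^ min s (n + 1 - s) : ℕ) : ℝ) * x ^ min s (n + 1 - s) := by gcongr
          _ = (n ^ 2 * x) ^ min s (n + 1 - s) := by push_cast; rw [mul_pow]
          _ ≤ n ^ 2 * x := pow_le_of_le_one (by positivity) h1 (by omega)
    _ = _ := by
        rw [Finset.sum_const, Finset.card_range, ← ENNReal.ofReal_nsmul, nsmul_eq_mul]
        congr 1; push_cast; ring

lemma measure_le_of_measurePreserving {Ω Ω' : Type*} [MeasurableSpace Ω] [MeasurableSpace Ω']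
    {μ : Measure Ω} {ν : Measure Ω'} {f : Ω → Ω'} (h : MeasurePreserving f μ ν) {s : Set Ω}
    {t : Set Ω'} (hst : ∀ x ∈ s, f x ∈ t) : μ s ≤ ν t :=
  calc μ s ≤ μ (f ⁻¹' t) := measure_mono hst
    _ ≤ μ.map f t := Measure.le_map_apply h.measurable.aemeasurable t
    _ = ν t := by rw [h.map_eq]

/-! ### Dense patterns and four-cycles -/

/-- The bipartite graph `L` contains none of five small patterns, each with one edge more than
vertices. Together they exclude that two distinct four-cycles meet. -/
structure NoDense {I J : Type*} (L : I → J → Prop) : Prop where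
  two_three : ∀ (x y : I) (a b c : J), x ≠ y → a ≠ b → a ≠ c → b ≠ c →
    L x a → L x b → L x c → L y a → L y b → L y c → False
  three_two : ∀ (x y z : I) (a b : J), x ≠ y → x ≠ z → y ≠ z → a ≠ b →
    L x a → L y a → L z a → L x b → L y b → L z b → False
  three_three : ∀ (x y z : I) (a b c : J), x ≠ y → x ≠ z → y ≠ z → a ≠ b → a ≠ c → b ≠ c →
    L x a → L x b → L x c → L y a → L y b → L z b → L z c → False
  three_four : ∀ (x y z : I) (a b c d : J), x ≠ y → x ≠ z → y ≠ z →
    a ≠ b → a ≠ c → a ≠ d → b ≠ c → b ≠ d → c ≠ d →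
    L x a → L x b → L x c → L x d → L y a → L y b → L z c → L z d → False
  four_three : ∀ (x y z w : I) (a b c : J), x ≠ y → x ≠ z → x ≠ w → y ≠ z → y ≠ w → z ≠ w →
    a ≠ b → a ≠ c → b ≠ c →
    L x a → L y a → L z a → L w a → L x b → L y b → L z c → L w c → False

lemma NoDense.flip {I J : Type*} {L : I → J → Prop} (h : NoDense L) :
    NoDense fun j i => L i j where
  two_three x y a b c hxy hab hac hbc h1 h2 h3 h4 h5 h6 :=
    h.three_two a b c x y hab hac hbc hxy h1 h2 h3 h4 h5 h6
  three_two x y z a b hxy hxz hyz hab h1 h2 h3 h4 h5 h6 :=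
    h.two_three a b x y z hab hxy hxz hyz h1 h2 h3 h4 h5 h6
  three_three x y z a b c hxy hxz hyz hab hac hbc h1 h2 h3 h4 h5 h6 h7 :=
    h.three_three b a c y x z hab.symm hbc hac hxy.symm hyz hxz h5 h2 h6 h4 h1 h3 h7
  three_four x y z a b c d hxy hxz hyz hab hac had hbc hbd hcd h1 h2 h3 h4 h5 h6 h7 h8 :=
    h.four_three a b c d x y z hab hac had hbc hbd hcd hxy hxz hyz h1 h2 h3 h4 h5 h6 h7 h8
  four_three x y z w a b c hxy hxz hxw hyz hyw hzw hab hac hbc h1 h2 h3 h4 h5 h6 h7 h8 :=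
    h.three_four a b c x y z w hab hac hbc hxy hxz hxw hyz hyw hzw h1 h2 h3 h4 h5 h6 h7 h8

/-- From each four-cycle, one of its two perfect matchings is selected. -/
def SelectedEdge {I J : Type*} [LinearOrder I] [LinearOrder J] (L : I → J → Prop) (i : I) (a : J) :
    Prop :=
  ∃ i' b, i' ≠ i ∧ b ≠ a ∧ L i a ∧ L i b ∧ L i' a ∧ L i' b ∧ (i < i' ↔ a < b)

section SelectedEdge

variable {I J : Type*} [LinearOrder I] [LinearOrder J] {L : I → J → Prop}

lemma SelectedEdge.flip {i : I} {a : J} (h : SelectedEdge L i a) :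
    SelectedEdge (fun j i => L i j) a i := by
  obtain ⟨i', b, h1, h2, h3, h4, h5, h6, h7⟩ := h
  exact ⟨b, i', h2, h1, h3, h5, h4, h6, h7.symm⟩

/-- Two different selected edges at `i` come from four-cycles through `i`. If the cycles differ,
their union contains one of the excluded patterns; the cases record which other vertices they share.
If they coincide, the order condition picks the monotone matching, which has only one edge at `i`.
-/
lemma SelectedEdge.right_unique (hL : NoDense L) {i : I} {a a' : J} (h : SelectedEdge L i a)
    (h' : SelectedEdge L i a') : a = a' := by
  obtain ⟨x, b, hx, hb, h1, h2, h3, h4, h5⟩ := h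
  obtain ⟨x', b', hx', hb', h1', h2', h3', h4', h5'⟩ := h'
  by_contra haa
  by_cases hxx : x = x'
  · subst hxx
    by_cases hab : a' = b
    · subst hab
      by_cases hba : b' = a
      · subst hba
        rcases lt_or_gt_of_ne haa with h | h
        · exact absurd (h5'.1 (h5.2 h)) h.not_gt
        · exact absurd (h5.1 (h5'.2 h)) h.not_gt
      · exact hL.two_three i x a a' b' hx.symm haa (Ne.symm hba) hb'.symm h1 h2 h2' h3 h4 h4'
    · exact hL.two_three i x a b a' hx.symm hb.symm haa (Ne.symm hab) h1 h2 h1' h3 h4 h3'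
  · by_cases hbb : b = b'
    · subst hbb
      exact hL.three_three i x x' a b a' hx.symm hx'.symm hxx hb.symm haa hb' h1 h2 h1' h3 h4 h4' h3'
    · by_cases hab : a' = b
      · subst hab
        by_cases hba : b' = a
        · subst hba
          exact hL.three_two i x x' b' a' hx.symm hx'.symm hxx haa h1 h3 h4' h2 h4 h3'
        · exact hL.three_three i x x' a a' b' hx.symm hx'.symm hxx haa (Ne.symm hba) hb'.symm
            h1 h2 h2' h3 h4 h3' h4'
      · by_cases hba : b' = a
        · subst hba
          exact hL.three_three i x x' b b' a' hx.symm hx'.symm hxx hb (Ne.symm hab) haa h2 h1 h1'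
            h4 h3 h4' h3'
        · exact hL.three_four i x x' a b a' b' hx.symm hx'.symm hxx hb.symm haa (Ne.symm hba)
            (Ne.symm hab) hbb hb'.symm h1 h2 h1' h2' h3 h4 h3' h4'

lemma SelectedEdge.left_unique (hL : NoDense L) {i i' : I} {a : J} (h : SelectedEdge L i a)
    (h' : SelectedEdge L i' a) : i = i' :=
  SelectedEdge.right_unique hL.flip h.flip h'.flip

/-- The two edges of the cycle at `i` lie in its two different perfect matchings, exactly one of
which is monotone. -/
lemma SelectedEdge.of_fourCycle {i i' : I} {a b : J} (hi : i' ≠ i) (hab : a ≠ b) (h1 : L i a)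
    (h2 : L i b) (h3 : L i' a) (h4 : L i' b) : SelectedEdge L i a ∨ SelectedEdge L i b := by
  by_cases h : i < i' ↔ a < b
  · exact .inl ⟨i', b, hi, hab.symm, h1, h2, h3, h4, h⟩
  · refine .inr ⟨i', a, hi, hab, h2, h1, h4, h3, ?_⟩
    rcases lt_or_gt_of_ne hi with h' | h' <;> rcases lt_or_gt_of_ne hab with h'' | h'' <;>
      simp_all [not_lt_of_gt]

end SelectedEdge

section DensePatterns

variable {D : Measure ℝ} [IsProbabilityMeasure D]
variable {I J : Type*} [Fintype I] [Fintype J]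

lemma cellLaw_exists_pattern (A : Set ℝ) {T : Type*} [Fintype T] (Q : T → Prop)
    (E : T → Finset (I × J)) {e : ℕ} (hE : ∀ t, Q t → (E t).card = e) :
    cellLaw D I J {u | ∃ t, Q t ∧ ∀ x ∈ E t, u x.1 x.2 ∈ A} ≤ Fintype.card T * D A ^ e := by
  classical
  calc _ ≤ cellLaw D I J (⋃ t ∈ Finset.univ.filter Q, {u | ∀ x ∈ E t, u x.1 x.2 ∈ A}) := by
        refine measure_mono ?_
        rintro u ⟨t, ht, hu⟩
        simp only [Set.mem_iUnion]
        exact ⟨t, by simpa using ht, hu⟩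
    _ ≤ ∑ t ∈ Finset.univ.filter Q, D A ^ e := by
        refine (measure_biUnion_finset_le _ _).trans (Finset.sum_le_sum fun t ht => ?_)
        rw [cellLaw_forall_mem, hE t (Finset.mem_filter.1 ht).2]
    _ ≤ _ := by
        rw [Finset.sum_const, nsmul_eq_mul]
        gcongr
        exact_mod_cast Finset.card_le_univ _

/-- A pattern with `v` vertices has at most `N ^ v` placements, each requiring `v + 1` distinct
cells in `A`. With `D A` of order `log N / N`, every term is polylogarithmic divided by `N`. -/
lemma cellLaw_not_noDense (A : Set ℝ) {N : ℕ} (hI : Fintype.card I ≤ N) (hJ : Fintype.card J ≤ N) :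
    cellLaw D I J {u | ¬ NoDense fun i j => u i j ∈ A} ≤
      2 * (N ^ 5 * D A ^ 6) + N ^ 6 * D A ^ 7 + 2 * (N ^ 7 * D A ^ 8) := by
  classical
  have h1 := cellLaw_exists_pattern (D := D) (I := I) (J := J) A (T := I × I × J × J × J) (e := 6)
    (fun ⟨x, y, a, b, c⟩ => x ≠ y ∧ a ≠ b ∧ a ≠ c ∧ b ≠ c)
    (fun ⟨x, y, a, b, c⟩ => {(x, a), (x, b), (x, c), (y, a), (y, b), (y, c)})
    (by rintro ⟨x, y, a, b, c⟩ h; simp_all [Finset.card_insert_of_notMem])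
  have h2 := cellLaw_exists_pattern (D := D) (I := I) (J := J) A (T := I × I × I × J × J) (e := 6)
    (fun ⟨x, y, z, a, b⟩ => x ≠ y ∧ x ≠ z ∧ y ≠ z ∧ a ≠ b)
    (fun ⟨x, y, z, a, b⟩ => {(x, a), (y, a), (z, a), (x, b), (y, b), (z, b)})
    (by rintro ⟨x, y, z, a, b⟩ h; simp_all [Finset.card_insert_of_notMem])
  have h3 := cellLaw_exists_pattern (D := D) (I := I) (J := J) A (T := I × I × I × J × J × J)
    (e := 7) (fun ⟨x, y, z, a, b, c⟩ => x ≠ y ∧ x ≠ z ∧ y ≠ z ∧ a ≠ b ∧ a ≠ c ∧ b ≠ c)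
    (fun ⟨x, y, z, a, b, c⟩ => {(x, a), (x, b), (x, c), (y, a), (y, b), (z, b), (z, c)})
    (by rintro ⟨x, y, z, a, b, c⟩ h; simp_all [Finset.card_insert_of_notMem])
  have h4 := cellLaw_exists_pattern (D := D) (I := I) (J := J) A (T := I × I × I × J × J × J × J)
    (e := 8) (fun ⟨x, y, z, a, b, c, d⟩ => x ≠ y ∧ x ≠ z ∧ y ≠ z ∧ a ≠ b ∧ a ≠ c ∧ a ≠ d ∧ b ≠ c ∧
      b ≠ d ∧ c ≠ d)
    (fun ⟨x, y, z, a, b, c, d⟩ =>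
      {(x, a), (x, b), (x, c), (x, d), (y, a), (y, b), (z, c), (z, d)})
    (by rintro ⟨x, y, z, a, b, c, d⟩ h; simp_all [Finset.card_insert_of_notMem])
  have h5 := cellLaw_exists_pattern (D := D) (I := I) (J := J) A (T := I × I × I × I × J × J × J)
    (e := 8) (fun ⟨x, y, z, w, a, b, c⟩ => x ≠ y ∧ x ≠ z ∧ x ≠ w ∧ y ≠ z ∧ y ≠ w ∧ z ≠ w ∧ a ≠ b ∧
      a ≠ c ∧ b ≠ c)
    (fun ⟨x, y, z, w, a, b, c⟩ =>
      {(x, a), (y, a), (z, a), (w, a), (x, b), (y, b), (z, c), (w, c)})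
    (by rintro ⟨x, y, z, w, a, b, c⟩ h; simp_all [Finset.card_insert_of_notMem])
  simp only [Fintype.card_prod, Prod.exists] at h1 h2 h3 h4 h5
  set k := (Fintype.card I : ℕ)
  set l := (Fintype.card J : ℕ)
  have c1 : k * (k * (l * (l * l))) ≤ N ^ 5 := by
    calc _ ≤ N * (N * (N * (N * N))) := by gcongr
      _ = _ := by ring
  have c2 : k * (k * (k * (l * l))) ≤ N ^ 5 := by
    calc _ ≤ N * (N * (N * (N * N))) := by gcongr
      _ = _ := by ring
  have c3 : k * (k * (k * (l * (l * l)))) ≤ N ^ 6 := by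
    calc _ ≤ N * (N * (N * (N * (N * N)))) := by gcongr
      _ = _ := by ring
  have c4 : k * (k * (k * (l * (l * (l * l))))) ≤ N ^ 7 := by
    calc _ ≤ N * (N * (N * (N * (N * (N * N))))) := by gcongr
      _ = _ := by ring
  have c5 : k * (k * (k * (k * (l * (l * l))))) ≤ N ^ 7 := by
    calc _ ≤ N * (N * (N * (N * (N * (N * N))))) := by gcongr
      _ = _ := by ring
  have hc : ∀ {v M : ℕ}, v ≤ M → ∀ e : ℕ, (v : ℝ≥0∞) * D A ^ e ≤ M * D A ^ e := fun h e => by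
    gcongr
  have f1 := h1.trans (hc c1 6)
  have f2 := h2.trans (hc c2 6)
  have f3 := h3.trans (hc c3 7)
  have f4 := h4.trans (hc c4 8)
  have f5 := h5.trans (hc c5 8)
  push_cast at f1 f2 f3 f4 f5
  refine (measure_mono fun u hu => ?_).trans (((measure_union_le _ _).trans (add_le_add
    ((measure_union_le _ _).trans (add_le_add ((measure_union_le _ _).trans (add_le_add
      ((measure_union_le _ _).trans (add_le_add f1 f2)) f3)) f4)) f5)).trans_eq ?_)
  · by_contra hcon
    simp only [Set.mem_union, not_or] at hcon
    obtain ⟨⟨⟨⟨g1, g2⟩, g3⟩, g4⟩, g5⟩ := hcon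
    refine hu ⟨?_, ?_, ?_, ?_, ?_⟩
    · intro x y a b c d1 d2 d3 d4 h1 h2 h3 h4 h5 h6
      refine g1 ⟨x, y, a, b, c, ⟨d1, d2, d3, d4⟩, ?_⟩
      simp only [Finset.mem_insert, Finset.mem_singleton, forall_eq_or_imp, forall_eq]
      exact ⟨h1, h2, h3, h4, h5, h6⟩
    · intro x y z a b d1 d2 d3 d4 h1 h2 h3 h4 h5 h6
      refine g2 ⟨x, y, z, a, b, ⟨d1, d2, d3, d4⟩, ?_⟩
      simp only [Finset.mem_insert, Finset.mem_singleton, forall_eq_or_imp, forall_eq]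
      exact ⟨h1, h2, h3, h4, h5, h6⟩
    · intro x y z a b c d1 d2 d3 d4 d5 d6 h1 h2 h3 h4 h5 h6 h7
      refine g3 ⟨x, y, z, a, b, c, ⟨d1, d2, d3, d4, d5, d6⟩, ?_⟩
      simp only [Finset.mem_insert, Finset.mem_singleton, forall_eq_or_imp, forall_eq]
      exact ⟨h1, h2, h3, h4, h5, h6, h7⟩
    · intro x y z a b c d d1 d2 d3 d4 d5 d6 d7 d8 d9 h1 h2 h3 h4 h5 h6 h7 h8
      refine g4 ⟨x, y, z, a, b, c, d, ⟨d1, d2, d3, d4, d5, d6, d7, d8, d9⟩, ?_⟩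
      simp only [Finset.mem_insert, Finset.mem_singleton, forall_eq_or_imp, forall_eq]
      exact ⟨h1, h2, h3, h4, h5, h6, h7, h8⟩
    · intro x y z w a b c d1 d2 d3 d4 d5 d6 d7 d8 d9 h1 h2 h3 h4 h5 h6 h7 h8
      refine g5 ⟨x, y, z, w, a, b, c, ⟨d1, d2, d3, d4, d5, d6, d7, d8, d9⟩, ?_⟩
      simp only [Finset.mem_insert, Finset.mem_singleton, forall_eq_or_imp, forall_eq]
      exact ⟨h1, h2, h3, h4, h5, h6, h7, h8⟩
  · ring

end DensePatterns

/-! ### Allocations that match every block of items -/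

open Classical in
/-- The block `l` of items has no sparse rectangle in the graph of entries at least `1 - τ`. -/
def BlockMatchable {n r : ℕ} (τ : ℝ) (u : Utilities n (r * n)) (l : Fin r) : Prop :=
  ¬ ∃ S T : Finset (Fin n), S.card + T.card = n + 1 ∧
    ((S ×ˢ T).filter fun x => u x.1 (finProdFinEquiv (l, x.2)) ∈ Set.Ici (1 - τ)).card ≤
      min S.card T.card

/-- Every block of `n` items can be matched to the agents so that no agent is envious and all
the items are valued at least `1 - τ` by their owners. -/
def HasGoodMatchings {n r : ℕ} (τ : ℝ) (u : Utilities n (r * n)) : Prop :=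
  ∃ π : Fin r → Equiv.Perm (Fin n), (∀ l i, 1 - τ ≤ u i (finProdFinEquiv (l, π l i))) ∧
    ∀ i i', ∑ l, u i (finProdFinEquiv (l, π l i')) ≤ ∑ l, u i (finProdFinEquiv (l, π l i))

/-- The hypothesis does not involve `R`, so a single event provides matchings that avoid any partial
matching, including one that depends on the utilities. -/
lemma BlockMatchable.exists_perm {n r : ℕ} {τ : ℝ} {u : Utilities n (r * n)} {l : Fin r}
    (h : BlockMatchable τ u l) {R : Fin n → Fin n → Prop}
    (hrow : ∀ i j j', R i j → R i j' → j = j') (hcol : ∀ i i' j, R i j → R i' j → i = i') :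
    ∃ π : Equiv.Perm (Fin n),
      ∀ i, 1 - τ ≤ u i (finProdFinEquiv (l, π i)) ∧ ¬ R i (π i) := by
  classical
  by_contra hc
  have := exists_sparse_rectangle (G := fun i j => 1 - τ ≤ u i (finProdFinEquiv (l, j))) hrow hcol
    hc
  refine h ?_
  obtain ⟨S, T, h1, h2⟩ := this
  refine ⟨S, T, h1, ?_⟩
  convert h2
  exact Iff.rfl

lemma utilityLaw_not_blockMatchable {D : Measure ℝ} [IsProbabilityMeasure D] {τ p : ℝ}
    (hp0 : 0 ≤ p) (hp : p ≤ D.real (Set.Ici (1 - τ))) {n r : ℕ} (hn : 1 ≤ n) :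
    utilityLaw D n (r * n) {u | ¬ ∀ l, BlockMatchable τ u l} ≤
      ENNReal.ofReal (r * ((n + 1) * n ^ 2 * Real.exp (1 - p * n / 4))) := by
  classical
  have hl : ∀ l : Fin r, utilityLaw D n (r * n) {u | ¬ BlockMatchable τ u l} ≤
      ENNReal.ofReal ((n + 1) * n ^ 2 * Real.exp (1 - p * n / 4)) := by
    intro l
    have he : Function.Injective fun k : Fin n => (finProdFinEquiv (l, k) : Fin (r * n)) :=
      fun k k' h => by simpa using h
    refine le_trans ?_ (cellLaw_sparse_rectangle (D := D) measurableSet_Ici hp0 hp hn)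
    have hmp := measurePreserving_columns (D := D) (I := Fin n) he
    refine measure_le_of_measurePreserving hmp fun u hu => ?_
    simp only [BlockMatchable, not_not, Set.mem_ofPred_eq] at hu
    exact hu
  calc _ ≤ utilityLaw D n (r * n) (⋃ l, {u | ¬ BlockMatchable τ u l}) := by
        refine measure_mono fun u hu => ?_
        simpa using hu
    _ ≤ ∑ l : Fin r, ENNReal.ofReal ((n + 1) * n ^ 2 * Real.exp (1 - p * n / 4)) :=
        (measure_iUnion_fintype_le _ _).trans (Finset.sum_le_sum fun l _ => hl l)
    _ = _ := by
        rw [Finset.sum_const, Finset.card_univ, Fintype.card_fin, ← ENNReal.ofReal_nsmul,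
          nsmul_eq_mul]

/-- If `i` envies `i'`, the two items of `i'` are together worth more than `2 - 2 * τ` to `i` and at
most one each, so each is worth at least `1 - 2 * τ`. Hence `i`, `i'` and these items form a
four-cycle in `L`, and the owner `i'` holds both of its items. One of her two edges is selected,
although the matchings avoid all selected edges. -/
lemma HasGoodMatchings.of_two {n : ℕ} {τ : ℝ} {u : Utilities n (2 * n)}
    (hu : ∀ i j, u i j ≤ 1) (hL : NoDense fun i j => 1 - 2 * τ ≤ u i j)
    (hb : ∀ l, BlockMatchable τ u l) : HasGoodMatchings τ u := by
  set L := fun i j => 1 - 2 * τ ≤ u i j with hLdef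
  have hπ := fun l => (hb l).exists_perm
    (R := fun i k => SelectedEdge L i (finProdFinEquiv (l, k)))
    (fun i j j' h h' => by simpa using SelectedEdge.right_unique hL h h')
    (fun i i' j h h' => SelectedEdge.left_unique hL h h')
  choose π hπ using hπ
  refine ⟨π, fun l i => (hπ l i).1, fun i i' => ?_⟩
  rw [Fin.sum_univ_two, Fin.sum_univ_two]
  by_contra! hlt
  have hii : i ≠ i' := by rintro rfl; exact lt_irrefl _ hlt
  have e0 := (hπ 0 i).1
  have e1 := (hπ 1 i).1
  have e2 := hu i (finProdFinEquiv (0, π 0 i'))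
  have e3 := hu i (finProdFinEquiv (1, π 1 i'))
  have e4 := (hπ 0 i').1
  have e5 := (hπ 1 i').1
  have hne : (finProdFinEquiv (0, π 0 i') : Fin (2 * n)) ≠ finProdFinEquiv (1, π 1 i') := by simp
  rcases SelectedEdge.of_fourCycle (L := L) hii hne (by simp only [hLdef]; linarith)
    (by simp only [hLdef]; linarith) (by simp only [hLdef]; linarith)
    (by simp only [hLdef]; linarith) with h | h
  · exact (hπ 0 i').2 h
  · exact (hπ 1 i').2 h

/-! ### A random perfect matching in every block -/

section MatchingAverage

variable {n : ℕ}

open Classical in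
/-- Indicator of a perfect matching in the graph of entries at least `1 - τ`. -/
noncomputable def matchingIndicator (τ : ℝ) (u : Fin n → Fin n → ℝ) (π : Equiv.Perm (Fin n)) :
    ℝ≥0∞ :=
  if ∀ i, 1 - τ ≤ u i (π i) then 1 else 0

/-- The exponential weight of an item's deficit. -/
noncomputable def deficitWeight (t x : ℝ) : ℝ≥0∞ := ENNReal.ofReal (Real.exp (-(t * (1 - x))))

/-- Average over the perfect matchings of the weight that agent `i` gives to the item matched
to `i'`. -/
noncomputable def matchingAverage (τ t : ℝ) (u : Fin n → Fin n → ℝ) (i i' : Fin n) : ℝ≥0∞ :=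
  (∑ π, matchingIndicator τ u π)⁻¹ *
    ∑ π : Equiv.Perm (Fin n), matchingIndicator τ u π * deficitWeight t (u i (π i'))

lemma measurable_deficitWeight (t : ℝ) : Measurable (deficitWeight t) := by
  unfold deficitWeight; fun_prop

lemma measurable_matchingIndicator (τ : ℝ) (π : Equiv.Perm (Fin n)) :
    Measurable fun u : Fin n → Fin n → ℝ => matchingIndicator τ u π := by
  unfold matchingIndicator
  refine Measurable.ite ?_ measurable_const measurable_const
  simp only [Set.ofPred_forall]
  exact MeasurableSet.iInter fun i => measurableSet_le measurable_const (measurable_cell _ _)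

lemma measurable_matchingAverage (τ t : ℝ) (i i' : Fin n) :
    Measurable fun u : Fin n → Fin n → ℝ => matchingAverage τ t u i i' := by
  unfold matchingAverage
  refine (Finset.measurable_sum _ fun π _ => measurable_matchingIndicator τ π).inv.mul
    (Finset.measurable_sum _ fun π _ => (measurable_matchingIndicator τ π).mul
      ((measurable_deficitWeight t).comp (measurable_cell _ _)))

lemma sum_matchingAverage_le (τ t : ℝ) (u : Fin n → Fin n → ℝ) (i : Fin n) :
    ∑ i', matchingAverage τ t u i i' ≤ ∑ j, deficitWeight t (u i j) := by
  unfold matchingAverage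
  rw [← Finset.mul_sum, Finset.sum_comm]
  simp only [← Finset.mul_sum]
  simp only [fun π : Equiv.Perm (Fin n) => Equiv.sum_comp π fun j => deficitWeight t (u i j)]
  rw [← Finset.sum_mul, ← mul_assoc]
  -- Only an inequality: without perfect matchings the normalised total mass is `⊤ * 0 = 0` instead
  -- of one.
  exact mul_le_of_le_one_left' (ENNReal.inv_mul_le_one _)

lemma matchingAverage_rows (τ t : ℝ) (u : Fin n → Fin n → ℝ) (σ : Equiv.Perm (Fin n))
    (i i' : Fin n) :
    matchingAverage τ t (fun a j => u (σ a) j) i i' = matchingAverage τ t u (σ i) (σ i') := by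
  have h : ∀ π : Equiv.Perm (Fin n), matchingIndicator τ (fun a j => u (σ a) j) π =
      matchingIndicator τ u (π * σ⁻¹) := by
    intro π
    unfold matchingIndicator
    congr 1
    refine propext ⟨fun h i => ?_, fun h i => ?_⟩
    · simpa using h (σ⁻¹ i)
    · simpa using h (σ i)
  unfold matchingAverage
  simp only [h]
  rw [← Equiv.sum_comp (Equiv.mulRight σ⁻¹) fun π => matchingIndicator τ u π,
    ← Equiv.sum_comp (Equiv.mulRight σ⁻¹) fun π =>
      matchingIndicator τ u π * deficitWeight t (u (σ i) (π (σ i')))]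
  simp

/-- Exchanging rows shows that the expectation is the same for all `i' ≠ i`. Every perfect matching
uses each item once, so the sum over `i'` is at most the total weight of all items for `i`, with
expectation at most `n * β / t`. The factor two absorbs `n / (n - 1)`. -/
lemma lintegral_matchingAverage_le {α β : ℝ} {D : Measure ℝ} [IsProbabilityMeasure D]
    (hD : IsPDFBounded α β D) (τ : ℝ) {t : ℝ} (ht : 0 < t) {i i' : Fin n} (hi : i ≠ i') :
    ∫⁻ u, matchingAverage τ t u i i' ∂cellLaw D (Fin n) (Fin n) ≤ ENNReal.ofReal (2 * β / t) := by
  have hsym : ∀ k ∈ Finset.univ.erase i, ∫⁻ u, matchingAverage τ t u i k ∂cellLaw D (Fin n) (Fin n) =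
      ∫⁻ u, matchingAverage τ t u i i' ∂cellLaw D (Fin n) (Fin n) := by
    intro k hk
    have hk := Finset.ne_of_mem_erase hk
    rw [← (measurePreserving_rows (Equiv.swap k i')).lintegral_comp
      (measurable_matchingAverage τ t i i')]
    simp only [matchingAverage_rows, Equiv.swap_apply_right,
      Equiv.swap_apply_of_ne_of_ne hk.symm hi]
  have hn : 2 ≤ n := by
    have h1 := i.isLt
    have h2 := i'.isLt
    have : (i : ℕ) ≠ i' := fun h => hi (Fin.ext h)
    omega
  have hsum : ((n - 1 : ℕ) : ℝ≥0∞) *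
      ∫⁻ u, matchingAverage τ t u i i' ∂cellLaw D (Fin n) (Fin n) ≤
      n * ENNReal.ofReal (β / t) := by
    calc _ = ∑ k ∈ Finset.univ.erase i,
          ∫⁻ u, matchingAverage τ t u i k ∂cellLaw D (Fin n) (Fin n) := by
          rw [Finset.sum_congr rfl hsym, Finset.sum_const, nsmul_eq_mul,
            Finset.card_erase_of_mem (Finset.mem_univ _), Finset.card_univ, Fintype.card_fin]
      _ ≤ ∑ k, ∫⁻ u, matchingAverage τ t u i k ∂cellLaw D (Fin n) (Fin n) :=
          Finset.sum_le_sum_of_subset (Finset.erase_subset _ _)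
      _ = ∫⁻ u, ∑ k, matchingAverage τ t u i k ∂cellLaw D (Fin n) (Fin n) :=
          (lintegral_finsetSum _ fun k _ => measurable_matchingAverage τ t i k).symm
      _ ≤ ∫⁻ u, ∑ j, deficitWeight t (u i j) ∂cellLaw D (Fin n) (Fin n) :=
          lintegral_mono fun u => sum_matchingAverage_le τ t u i
      _ = ∑ j : Fin n, ∫⁻ u, deficitWeight t (u i j) ∂cellLaw D (Fin n) (Fin n) :=
          lintegral_finsetSum _ fun j _ => (measurable_deficitWeight t).comp (measurable_cell _ _)
      _ ≤ ∑ j : Fin n, ENNReal.ofReal (β / t) := by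
          refine Finset.sum_le_sum fun j _ => ?_
          have : MeasurePreserving (fun u : Fin n → Fin n → ℝ => u i j)
              (cellLaw D (Fin n) (Fin n)) D :=
            (measurePreserving_eval (fun _ : Fin n => D) j).comp
              (measurePreserving_eval (fun _ : Fin n => Measure.pi fun _ : Fin n => D) i)
          rw [this.lintegral_comp (measurable_deficitWeight t)]
          exact hD.lintegral_exp_le ht
      _ = _ := by
          rw [Finset.sum_const, Finset.card_univ, Fintype.card_fin, nsmul_eq_mul]
  have hb : (n : ℝ≥0∞) ≤ ((n - 1 : ℕ) : ℝ≥0∞) * 2 := by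
    exact_mod_cast (by omega : n ≤ (n - 1) * 2)
  have h2 : ((n - 1 : ℕ) : ℝ≥0∞) *
      ∫⁻ u, matchingAverage τ t u i i' ∂cellLaw D (Fin n) (Fin n) ≤
      ((n - 1 : ℕ) : ℝ≥0∞) * ENNReal.ofReal (2 * β / t) := by
    refine hsum.trans ?_
    rw [mul_div_assoc, ENNReal.ofReal_mul two_pos.le, ENNReal.ofReal_ofNat, ← mul_assoc]
    gcongr
  exact (ENNReal.mul_le_mul_iff_right (by exact_mod_cast (by omega : n - 1 ≠ 0)) (ENNReal.natCast_ne_top _)).1 h2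

variable {r : ℕ}

/-- If the averaged number of envious pairs is less than one, some choice of perfect matchings
is envy-free. -/
lemma exists_matchings_of_sum_lt_one {τ t : ℝ} (ht : 0 ≤ t) {v : Fin r → Fin n → Fin n → ℝ}
    (hex : ∀ l, ∃ π : Equiv.Perm (Fin n), ∀ i, 1 - τ ≤ v l i (π i))
    (hsum : ∑ x ∈ Finset.univ.offDiag, ENNReal.ofReal (Real.exp (t * r * τ)) *
      ∏ l, matchingAverage τ t (v l) x.1 x.2 < 1) :
    ∃ π : Fin r → Equiv.Perm (Fin n), (∀ l i, 1 - τ ≤ v l i (π l i)) ∧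
      ∀ i i', ∑ l, v l i (π l i') ≤ ∑ l, v l i (π l i) := by
  classical
  by_contra! hcon
  refine hsum.not_ge ?_
  set c : Fin r → ℝ≥0∞ := fun l => ∑ π, matchingIndicator τ (v l) π with hc
  have hc0 : ∀ l, c l ≠ 0 := by
    intro l
    obtain ⟨π, hπ⟩ := hex l
    have : matchingIndicator τ (v l) π = 1 := if_pos hπ
    rw [hc]
    simp only [ne_eq, Finset.sum_eq_zero_iff, Finset.mem_univ, true_implies]
    exact fun h => by simp [h π] at this
  have hctop : ∀ l, c l ≠ ⊤ := fun l => by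
    rw [hc]
    refine ENNReal.sum_ne_top.2 fun π _ => ?_
    unfold matchingIndicator
    split_ifs <;> simp
  -- Total mass of the product of the uniform distributions on the perfect matchings of the blocks.
  -- The sum in `hsum` is an expectation under this distribution, and every choice in its support
  -- will contribute at least its own mass.
  have hone : (1 : ℝ≥0∞) = ∑ p : Fin r → Equiv.Perm (Fin n),
      ∏ l, (c l)⁻¹ * matchingIndicator τ (v l) (p l) := by
    rw [← Fintype.prod_sum (fun (l : Fin r) π => (c l)⁻¹ * matchingIndicator τ (v l) π)]
    symm
    refine Finset.prod_eq_one fun l _ => ?_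
    rw [← Finset.mul_sum]
    exact ENNReal.inv_mul_cancel (hc0 l) (hctop l)
  have hrew : ∀ x : Fin n × Fin n, ∏ l, matchingAverage τ t (v l) x.1 x.2 =
      ∑ p : Fin r → Equiv.Perm (Fin n), (∏ l, (c l)⁻¹ * matchingIndicator τ (v l) (p l)) *
        ∏ l, deficitWeight t (v l x.1 (p l x.2)) := by
    intro x
    simp only [← Finset.prod_mul_distrib]
    rw [← Fintype.prod_sum (fun (l : Fin r) π => (c l)⁻¹ * matchingIndicator τ (v l) π *
      deficitWeight t (v l x.1 (π x.2)))]
    refine Finset.prod_congr rfl fun l _ => ?_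
    simp only [matchingAverage, Finset.mul_sum, mul_assoc, hc]
  simp only [hrew, Finset.mul_sum]
  rw [Finset.sum_comm, hone]
  refine Finset.sum_le_sum fun p _ => ?_
  by_cases hp : ∀ l i, 1 - τ ≤ v l i (p l i)
  · obtain ⟨i, i', hlt⟩ := hcon p hp
    have hii : i ≠ i' := by rintro rfl; exact lt_irrefl _ hlt
    -- One envious pair suffices: agent `i` owns at least `r * (1 - τ)` and values the bundle of
    -- `i'` more, so the total exponent is nonnegative.
    refine le_trans ?_ (Finset.single_le_sum (f := fun x : Fin n × Fin n =>
      ENNReal.ofReal (Real.exp (t * r * τ)) *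
        ((∏ l, (c l)⁻¹ * matchingIndicator τ (v l) (p l)) *
          ∏ l, deficitWeight t (v l x.1 (p l x.2)))) (fun _ _ => zero_le)
      (show (i, i') ∈ Finset.univ.offDiag by simpa using hii))
    rw [mul_left_comm]
    refine le_mul_of_one_le_right' ?_
    simp only [deficitWeight]
    rw [← ENNReal.ofReal_prod_of_nonneg fun l _ => (Real.exp_pos _).le, ← Real.exp_sum,
      ← ENNReal.ofReal_mul (Real.exp_pos _).le, ← Real.exp_add, ENNReal.one_le_ofReal,
      Real.one_le_exp_iff]
    have h1 : (r : ℝ) * (1 - τ) ≤ ∑ l, v l i (p l i) := by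
      calc (r : ℝ) * (1 - τ) = ∑ l : Fin r, (1 - τ) := by
            rw [Finset.sum_const, Finset.card_univ, Fintype.card_fin, nsmul_eq_mul]
        _ ≤ _ := Finset.sum_le_sum fun l _ => hp l i
    have h2 : ∑ l, -(t * (1 - v l i (p l i'))) = t * (∑ l, v l i (p l i') - r) := by
      rw [Finset.sum_neg_distrib, ← Finset.mul_sum, Finset.sum_sub_distrib]
      simp; ring
    rw [h2]
    nlinarith [mul_le_mul_of_nonneg_left (h1.trans hlt.le) ht]
  · push Not at hp
    obtain ⟨l, i, hl⟩ := hp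
    have : ∏ l, (c l)⁻¹ * matchingIndicator τ (v l) (p l) = 0 := by
      refine Finset.prod_eq_zero (Finset.mem_univ l) ?_
      rw [matchingIndicator, if_neg fun h => (h i).not_gt hl, mul_zero]
    rw [this]
    exact zero_le

/-- Taking `t = τ⁻¹` turns the prefactor into `exp r`, and independence of the blocks gives `(2 * β
* τ) ^ r` for each ordered pair. Markov's inequality then bounds the probability that the weighted
sum reaches one. -/
lemma utilityLaw_not_hasGoodMatchings {α β : ℝ} {D : Measure ℝ} [IsProbabilityMeasure D]
    (hD : IsPDFBounded α β D) {τ p : ℝ} (hτ : 0 < τ) (hp0 : 0 ≤ p)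
    (hp : p ≤ D.real (Set.Ici (1 - τ))) (hn : 1 ≤ n) :
    utilityLaw D n (r * n) {u | ¬ HasGoodMatchings τ u} ≤
      ENNReal.ofReal (r * ((n + 1) * n ^ 2 * Real.exp (1 - p * n / 4))) +
        ENNReal.ofReal (n ^ 2 * (2 * Real.exp 1 * β * τ) ^ r) := by
  set W : (Fin r → Fin n → Fin n → ℝ) → ℝ≥0∞ := fun v =>
    ∑ x ∈ Finset.univ.offDiag, ENNReal.ofReal (Real.exp (τ⁻¹ * r * τ)) *
      ∏ l, matchingAverage τ τ⁻¹ (v l) x.1 x.2 with hW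
  have hβ : 0 ≤ β := hD.2.1.le
  have hprod : ∀ x : Fin n × Fin n, Measurable fun v : Fin r → Fin n → Fin n → ℝ =>
      ∏ l, matchingAverage τ τ⁻¹ (v l) x.1 x.2 := fun x =>
    Finset.measurable_prod _ fun l _ =>
      (measurable_matchingAverage τ τ⁻¹ x.1 x.2).comp (measurable_pi_apply l)
  have hWm : Measurable W := Finset.measurable_sum _ fun x _ => (hprod x).const_mul _
  have hWbound : (Measure.pi fun _ : Fin r => cellLaw D (Fin n) (Fin n)) {v | 1 ≤ W v} ≤
      ENNReal.ofReal (n ^ 2 * (2 * Real.exp 1 * β * τ) ^ r) := by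
    refine (measure_le_lintegral_of_one_le W hWm fun _ h => h).trans ?_
    simp only [hW]
    rw [lintegral_finsetSum _ fun x _ => (hprod x).const_mul _]
    calc _ ≤ ∑ x ∈ (Finset.univ : Finset (Fin n)).offDiag,
          ENNReal.ofReal ((2 * Real.exp 1 * β * τ) ^ r) := by
          refine Finset.sum_le_sum fun x hx => ?_
          rw [lintegral_const_mul _ (hprod x), lintegral_pi_prod _
            (fun _ w => matchingAverage τ τ⁻¹ w x.1 x.2)
            fun _ => measurable_matchingAverage τ τ⁻¹ x.1 x.2, Finset.prod_const,
            Finset.card_univ, Fintype.card_fin]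
          have := lintegral_matchingAverage_le hD τ (inv_pos.2 hτ)
            (i := x.1) (i' := x.2) (by simpa using hx)
          calc _ ≤ ENNReal.ofReal (Real.exp (τ⁻¹ * r * τ)) *
                ENNReal.ofReal (2 * β / τ⁻¹) ^ r := by gcongr
            _ = ENNReal.ofReal (Real.exp (τ⁻¹ * r * τ) * (2 * β / τ⁻¹) ^ r) := by
                rw [ENNReal.ofReal_mul (Real.exp_pos _).le, ENNReal.ofReal_pow (by positivity)]
            _ = _ := by
                congr 1
                rw [mul_right_comm, inv_mul_cancel₀ hτ.ne', one_mul, ← mul_one (r : ℝ),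
                  Real.exp_nat_mul, ← mul_pow, div_inv_eq_mul]
                ring
      _ ≤ _ := by
          rw [Finset.sum_const, ← ENNReal.ofReal_nsmul, nsmul_eq_mul]
          refine ENNReal.ofReal_le_ofReal ?_
          gcongr
          rw [Finset.offDiag_card, Finset.card_univ, Fintype.card_fin, ← Nat.cast_pow]
          exact_mod_cast (Nat.sub_le _ _).trans (by rw [sq])
  have hmp := measurePreserving_blocks (D := D) (I := Fin n) (K := Fin n) (L := Fin r)
    (J := Fin (r * n)) finProdFinEquiv.symm
  have hset : MeasurableSet {u : Utilities n (r * n) |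
      1 ≤ W fun l i k => u i (finProdFinEquiv (l, k))} := by
    refine measurableSet_le measurable_const (hWm.comp ?_)
    exact measurable_pi_lambda _ fun l => measurable_cells fun i k => measurable_cell _ _
  have h2 : utilityLaw D n (r * n) {u | 1 ≤ W fun l i k => u i (finProdFinEquiv (l, k))} ≤
      ENNReal.ofReal (n ^ 2 * (2 * Real.exp 1 * β * τ) ^ r) := by
    refine le_trans (le_of_eq ?_) hWbound
    have := hmp.measure_preimage hset.nullMeasurableSet
    refine this.symm.trans ?_
    congr 1
    ext v
    simp only [Set.mem_preimage, Set.mem_ofPred_eq, Equiv.symm_apply_apply]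
  refine (measure_mono fun u hu => ?_).trans ((measure_union_le _ _).trans
    (add_le_add (utilityLaw_not_blockMatchable hp0 hp hn) h2))
  by_contra hcon
  simp only [Set.mem_union, Set.mem_ofPred_eq, not_or, not_not, not_le] at hcon
  refine hu ?_
  refine exists_matchings_of_sum_lt_one (τ := τ) (t := τ⁻¹) (inv_pos.2 hτ).le
    (v := fun l i k => u i (finProdFinEquiv (l, k))) (fun l => ?_) hcon.2
  obtain ⟨π, hπ⟩ := (hcon.1 l).exists_perm (R := fun _ _ => False) (by simp) (by simp)
  exact ⟨π, fun i => (hπ i).1⟩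

end MatchingAverage

/-! ### Existence of balanced envy-free allocations -/

lemma HasGoodMatchings.exists_isGoodEnvyFree {n r : ℕ} {C τ : ℝ} {u : Utilities n (r * n)}
    (h : HasGoodMatchings τ u) (hτ : τ = C * (Real.logb 2 (r * n : ℕ) / n)) :
    ∃ M : Bundles n (r * n), IsGoodEnvyFree C u M := by
  classical
  obtain ⟨π, h1, h2⟩ := h
  have hinj : ∀ i, Function.Injective fun l => (finProdFinEquiv (l, π l i) : Fin (r * n)) :=
    fun i l l' h => (Prod.ext_iff.1 (finProdFinEquiv.injective h)).1
  have hval : ∀ i i', bundleValue u i (Finset.univ.image fun l => finProdFinEquiv (l, π l i')) =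
      ∑ l, u i (finProdFinEquiv (l, π l i')) := fun i i' => by
    rw [bundleValue, Finset.sum_image (hinj i').injOn]
  refine ⟨fun i => Finset.univ.image fun l => finProdFinEquiv (l, π l i), fun j => ?_,
    fun i i' => ?_, fun i i' => ?_, fun i j hj => ?_⟩
  · obtain ⟨⟨l, k⟩, rfl⟩ := finProdFinEquiv.surjective j
    refine ⟨(π l).symm k, ?_, fun i hi => ?_⟩
    · exact Finset.mem_image.2 ⟨l, Finset.mem_univ _, by simp⟩
    · obtain ⟨l', -, hl'⟩ := Finset.mem_image.1 hi
      have := Prod.ext_iff.1 (finProdFinEquiv.injective hl')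
      obtain ⟨rfl, rfl⟩ := this
      simp
  · rw [hval, hval]
    exact h2 i i'
  · rw [Finset.card_image_of_injective _ (hinj i), Finset.card_image_of_injective _ (hinj i')]
  · obtain ⟨l, -, rfl⟩ := Finset.mem_image.1 hj
    rw [← hτ]
    exact h1 l i

lemma measurable_bundleValue {n m : ℕ} (i : Fin n) (S : Finset (Fin m)) :
    Measurable fun u : Utilities n m => bundleValue u i S :=
  Finset.measurable_sum _ fun j _ => measurable_cell i j

lemma measurableSet_isGoodEnvyFree (C : ℝ) {n m : ℕ} (M : Bundles n m) :
    MeasurableSet {u : Utilities n m | IsGoodEnvyFree C u M} := by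
  have h1 : MeasurableSet {u : Utilities n m | IsEnvyFree u M} := by
    simp only [IsEnvyFree, Set.ofPred_forall]
    exact MeasurableSet.iInter fun i => MeasurableSet.iInter fun i' =>
      measurableSet_le (measurable_bundleValue i _) (measurable_bundleValue i _)
  have h2 : MeasurableSet {u : Utilities n m |
      ∀ i, ∀ j ∈ M i, 1 - C * (Real.logb 2 m / n) ≤ u i j} := by
    simp only [Set.ofPred_forall]
    exact MeasurableSet.iInter fun i => MeasurableSet.iInter fun j => MeasurableSet.iInter fun _ =>
      measurableSet_le measurable_const (measurable_cell i j)
  exact (MeasurableSet.const _).inter (h1.inter ((MeasurableSet.const _).inter h2))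

open Classical in
/-- Exhaustive search for a balanced envy-free allocation. -/
noncomputable def exhaustiveSearch (C : ℝ) : AllocationAlgorithm where
  run n m u := if h : {M : Bundles n m | IsGoodEnvyFree C u M}.Nonempty then h.some else fun _ => ∅
  measurableSet_run_eq n m M := by
    -- The output depends on `u` only through the set of good families of bundles, which takes
    -- finitely many values; each value occurs on a measurable set.
    set f : Set (Bundles n m) → Bundles n m := fun S =>
      if h : S.Nonempty then h.some else fun _ => ∅
    have e : {u | f {M | IsGoodEnvyFree C u M} = M} =
        ⋃ S ∈ {S | f S = M}, {u : Utilities n m | {M | IsGoodEnvyFree C u M} = S} := by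
      ext u; simp
    change MeasurableSet {u | f {M | IsGoodEnvyFree C u M} = M}
    rw [e]
    refine MeasurableSet.biUnion (Set.to_countable _) fun S _ => ?_
    have e' : {u : Utilities n m | {M | IsGoodEnvyFree C u M} = S} =
        ⋂ M, {u : Utilities n m | IsGoodEnvyFree C u M ↔ M ∈ S} := by
      ext u; simp [Set.ext_iff]
    rw [e']
    refine MeasurableSet.iInter fun M => ?_
    by_cases hM : M ∈ S
    · simp only [hM, iff_true]
      exact measurableSet_isGoodEnvyFree C M
    · simp only [hM, iff_false]
      exact (measurableSet_isGoodEnvyFree C M).compl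

lemma exhaustiveSearch_isGood {C : ℝ} {n m : ℕ} {u : Utilities n m}
    (h : ∃ M : Bundles n m, IsGoodEnvyFree C u M) :
    IsGoodEnvyFree C u ((exhaustiveSearch C).run n m u) := by
  have h' : {M : Bundles n m | IsGoodEnvyFree C u M}.Nonempty := h
  simp only [exhaustiveSearch, dif_pos h']
  exact h'.some_mem

/-! ### Estimates of the failure probability -/

/-- With `N = 2 * n` vertices at most on each side and edge probability at most `a = 2 * β * τ`, a
pattern count `N ^ v * a ^ (v + 1)` equals `(N * a) ^ (v + 1) / N`. The eighth power of `1 + N * a`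
dominates all five. -/
lemma utilityLaw_not_hasGoodMatchings_two {α β : ℝ} {D : Measure ℝ} [IsProbabilityMeasure D]
    (hD : IsPDFBounded α β D) {τ p : ℝ} (hτ : 0 ≤ τ) (hp0 : 0 ≤ p)
    (hp : p ≤ D.real (Set.Ici (1 - τ))) {n : ℕ} (hn : 1 ≤ n) :
    utilityLaw D n (2 * n) {u | ¬ HasGoodMatchings τ u} ≤
      ENNReal.ofReal ((2 : ℕ) * ((n + 1) * n ^ 2 * Real.exp (1 - p * n / 4))) +
        ENNReal.ofReal (5 * (1 + 4 * β * (n * τ)) ^ 8 / (2 * n)) := by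
  have hβ : 0 ≤ β := hD.2.1.le
  have h1 := utilityLaw_not_blockMatchable (r := 2) hp0 hp hn
  have h2 := cellLaw_unit hD (Fin n) (Fin (2 * n))
  have h3 := cellLaw_not_noDense (D := D) (I := Fin n) (J := Fin (2 * n)) (Set.Ici (1 - 2 * τ))
    (N := 2 * n) (by simp; omega) (by simp)
  have hn0 : (0 : ℝ) < n := by exact_mod_cast hn
  have h4 : 2 * (((2 * n : ℕ) : ℝ≥0∞) ^ 5 * D (Set.Ici (1 - 2 * τ)) ^ 6) +
      ((2 * n : ℕ) : ℝ≥0∞) ^ 6 * D (Set.Ici (1 - 2 * τ)) ^ 7 +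
      2 * (((2 * n : ℕ) : ℝ≥0∞) ^ 7 * D (Set.Ici (1 - 2 * τ)) ^ 8) ≤
      ENNReal.ofReal (5 * (1 + 4 * β * (n * τ)) ^ 8 / (2 * n)) := by
    set N : ℝ := 2 * n with hN
    have hNpos : 0 < N := by positivity
    set a : ℝ := β * (2 * τ) with ha
    have ha0 : 0 ≤ a := by positivity
    have hNa : 4 * β * (n * τ) = N * a := by rw [hN, ha]; ring
    have hNc : ((2 * n : ℕ) : ℝ≥0∞) = ENNReal.ofReal N := by
      rw [hN, ← ENNReal.ofReal_natCast]; push_cast; rfl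
    have hA : D (Set.Ici (1 - 2 * τ)) ≤ ENNReal.ofReal a := hD.apply_Ici_le (2 * τ)
    clear_value N a
    calc _ ≤ 2 * (ENNReal.ofReal N ^ 5 * ENNReal.ofReal a ^ 6) +
          ENNReal.ofReal N ^ 6 * ENNReal.ofReal a ^ 7 +
          2 * (ENNReal.ofReal N ^ 7 * ENNReal.ofReal a ^ 8) := by rw [hNc]; gcongr
      _ = ENNReal.ofReal (2 * (N ^ 5 * a ^ 6) + N ^ 6 * a ^ 7 + 2 * (N ^ 7 * a ^ 8)) := by
          have hk : ∀ k l : ℕ, ENNReal.ofReal (N ^ k * a ^ l) =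
              ENNReal.ofReal N ^ k * ENNReal.ofReal a ^ l := fun k l => by
            rw [ENNReal.ofReal_mul (by positivity), ENNReal.ofReal_pow hNpos.le,
              ENNReal.ofReal_pow ha0]
          rw [ENNReal.ofReal_add (by positivity) (by positivity),
            ENNReal.ofReal_add (by positivity) (by positivity),
            ENNReal.ofReal_mul two_pos.le, ENNReal.ofReal_mul two_pos.le, hk, hk, hk,
            ENNReal.ofReal_ofNat]
      _ ≤ _ := by
          refine ENNReal.ofReal_le_ofReal ?_
          rw [le_div_iff₀ hNpos, hNa]
          set y := N * a with hy
          have hy0 : 0 ≤ y := by positivity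
          have g1 : y ^ 6 ≤ (1 + y) ^ 8 := (pow_le_pow_left₀ hy0 (by linarith) 6).trans
            (pow_le_pow_right₀ (by linarith) (by norm_num))
          have g2 : y ^ 7 ≤ (1 + y) ^ 8 := (pow_le_pow_left₀ hy0 (by linarith) 7).trans
            (pow_le_pow_right₀ (by linarith) (by norm_num))
          have g3 : y ^ 8 ≤ (1 + y) ^ 8 := pow_le_pow_left₀ hy0 (by linarith) 8
          calc _ = 2 * y ^ 6 + y ^ 7 + 2 * y ^ 8 := by rw [hy]; ring
            _ ≤ _ := by linarith
  refine (measure_mono fun u hu => ?_).trans ((measure_union_le _ _).trans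
    (add_le_add h1 ((measure_union_le _ _).trans (add_le_add h2.le (h3.trans h4)))))
    |>.trans_eq (by rw [zero_add])
  by_contra hcon
  simp only [Set.mem_union, Set.mem_ofPred_eq, not_or, not_not, Set.mem_compl_iff] at hcon
  exact hu (HasGoodMatchings.of_two (fun i j => (hcon.2.1 i j).2) hcon.2.2 hcon.1)

lemma log_le_logb_two {x : ℝ} (hx : 1 ≤ x) : Real.log x ≤ Real.logb 2 x := by
  rw [Real.logb, le_div_iff₀ (Real.log_pos one_lt_two)]
  have := Real.log_two_lt_d9
  nlinarith [Real.log_nonneg hx]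

lemma matching_failure_le {n r : ℕ} (hn : 1 ≤ n) (hr : 1 ≤ r) :
    (r : ℝ) * ((n + 1) * n ^ 2 * Real.exp (1 - 6 * Real.logb 2 (r * n : ℕ))) ≤ 6 / n := by
  have hn' : (1 : ℝ) ≤ n := by exact_mod_cast hn
  have hr' : (1 : ℝ) ≤ r := by exact_mod_cast hr
  set m : ℝ := r * n with hm
  have hm1 : 1 ≤ m := by nlinarith
  have hnm : (n : ℝ) ≤ m := by nlinarith
  have hlog := log_le_logb_two hm1
  have hexp : Real.exp (1 - 6 * Real.logb 2 (r * n : ℕ)) ≤ 3 * (m ^ 6)⁻¹ := by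
    calc _ ≤ Real.exp (1 - 6 * Real.log m) := by
          push_cast; rw [← hm]
          exact Real.exp_le_exp.2 (by linarith)
      _ = Real.exp 1 * (m ^ 6)⁻¹ := by
          rw [Real.exp_sub, div_eq_mul_inv, show (6 : ℝ) = ((6 : ℕ) : ℝ) by norm_num,
            Real.exp_nat_mul, Real.exp_log (by positivity)]
      _ ≤ _ := by
          gcongr
          linarith [Real.exp_one_lt_d9]
  calc _ ≤ (r : ℝ) * ((n + n) * n ^ 2 * (3 * (m ^ 6)⁻¹)) := by gcongr
    _ = 6 * (m * n ^ 2) * (m ^ 6)⁻¹ := by rw [hm]; ring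
    _ ≤ 6 * (m * m ^ 2) * (m ^ 6)⁻¹ := by gcongr
    _ = 6 * (m ^ 3)⁻¹ := by field_simp
    _ ≤ 6 * (n : ℝ)⁻¹ := by
        gcongr
        exact hnm.trans (le_self_pow₀ hm1 (by norm_num))
    _ = _ := by rw [div_eq_mul_inv]

lemma tendsto_logb_pow_div (k : ℕ) :
    Tendsto (fun n : ℕ => Real.logb 2 n ^ k / n) atTop (𝓝 0) :=
  ((isLittleO_iff_tendsto' ((eventually_ne_atTop 0).mono fun _ hx h => absurd h hx)).1
    (Real.isLittleO_pow_logb_id_atTop (b := 2) (n := k))).comp tendsto_natCast_atTop_atTop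

/-- A bound for the failure probability that tends to zero. -/
noncomputable def failureBound (α β : ℝ) (n : ℕ) : ℝ :=
  -- In order: an unmatchable block; dense patterns, for `r = 2`; the averaging bound for `3 ≤ r ≤
  -- n`; the averaging bound for `r > n`.
  6 / n + (5 * (1 + 4 * β * (24 / α)) ^ 8 * (Real.logb 2 (2 * n : ℕ) ^ 8 / (2 * n : ℕ)) +
    ((2 * (2 * Real.exp 1 * β) * (24 / α)) ^ 3 * (Real.logb 2 n ^ 3 / n) +
      n ^ 2 * (1 / 4 : ℝ) ^ n))

lemma tendsto_failureBound (α β : ℝ) : Tendsto (failureBound α β) atTop (𝓝 0) := by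
  have h1 : Tendsto (fun n : ℕ => (6 : ℝ) / n) atTop (𝓝 0) := tendsto_const_div_atTop_nhds_zero_nat 6
  have h2 := ((tendsto_logb_pow_div 8).comp
    (tendsto_id.const_mul_atTop' (two_pos : 0 < 2))).const_mul (5 * (1 + 4 * β * (24 / α)) ^ 8)
  have h3 := (tendsto_logb_pow_div 3).const_mul ((2 * (2 * Real.exp 1 * β) * (24 / α)) ^ 3)
  have h4 := tendsto_pow_const_mul_const_pow_of_lt_one 2 (r := 1 / 4) (by norm_num) (by norm_num)
  have := h1.add (h2.add (h3.add h4))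
  simp only [mul_zero, add_zero] at this
  exact this

lemma utilityLaw_not_exists_isGoodEnvyFree {α β : ℝ} {D : Measure ℝ} [IsProbabilityMeasure D]
    (hD : IsPDFBounded α β D) {n r : ℕ} (hn : 1 ≤ n) (hr : 2 ≤ r) {τ : ℝ}
    (hτ : τ = 24 / α * (Real.logb 2 (r * n : ℕ) / n)) (hτ1 : τ ≤ 1)
    (hτ4 : 2 * Real.exp 1 * β * τ ≤ 1 / 4) :
    utilityLaw D n (r * n) {u | ¬ ∃ M : Bundles n (r * n), IsGoodEnvyFree (24 / α) u M} ≤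
      ENNReal.ofReal (failureBound α β n) := by
  have hα : 0 < α := hD.1
  have hβ : 0 < β := hD.2.1
  have hn' : (1 : ℝ) ≤ n := by exact_mod_cast hn
  have hr' : (2 : ℝ) ≤ r := by exact_mod_cast hr
  have hm2 : (2 : ℝ) ≤ (r * n : ℕ) := by push_cast; nlinarith
  have hL : 1 ≤ Real.logb 2 (r * n : ℕ) := by
    rw [Real.le_logb_iff_rpow_le one_lt_two (by linarith)]; simpa using hm2
  have hLn : 0 ≤ Real.logb 2 (n : ℝ) := Real.logb_nonneg one_lt_two hn'
  have hτ0 : 0 < τ := by rw [hτ]; positivity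
  have hp : α * τ ≤ D.real (Set.Ici (1 - τ)) := by
    have := hD.le_apply_Ici hτ1
    rwa [← ofReal_measureReal, ENNReal.ofReal_le_ofReal_iff measureReal_nonneg] at this
  -- The constant 24 is chosen here: the exponent from the rectangle bound becomes `6 * log m`,
  -- enough to absorb the polynomial union bound.
  have hpn : α * τ * n / 4 = 6 * Real.logb 2 (r * n : ℕ) := by
    rw [hτ]; field_simp; norm_num
  have hq := matching_failure_le hn (by omega : 1 ≤ r)
  rw [← hpn] at hq
  refine (measure_mono (t := {u | ¬ HasGoodMatchings τ u}) ?_).trans ?_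
  · exact fun u hu h => hu (h.exists_isGoodEnvyFree hτ)
  have hlogs : ∀ k : ℕ, 0 ≤ Real.logb 2 ((2 * n : ℕ) : ℝ) ^ k / (2 * n : ℕ) := fun k => by
    have : 0 ≤ Real.logb 2 ((2 * n : ℕ) : ℝ) :=
      Real.logb_nonneg one_lt_two (by push_cast; linarith)
    positivity
  have hB3 : 0 ≤ (2 * (2 * Real.exp 1 * β) * (24 / α)) ^ 3 * (Real.logb 2 n ^ 3 / n) := by
    positivity
  have hB2 : 0 ≤ 5 * (1 + 4 * β * (24 / α)) ^ 8 *
      (Real.logb 2 ((2 * n : ℕ) : ℝ) ^ 8 / (2 * n : ℕ)) :=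
    mul_nonneg (by positivity) (hlogs 8)
  have hB4 : 0 ≤ (n : ℝ) ^ 2 * (1 / 4 : ℝ) ^ n := by positivity
  rcases hr.eq_or_lt with rfl | hr3
  · refine (utilityLaw_not_hasGoodMatchings_two hD hτ0.le (by positivity) hp hn).trans ?_
    rw [← ENNReal.ofReal_add (by positivity) (by positivity)]
    refine ENNReal.ofReal_le_ofReal (add_le_add hq ?_)
    have hnτ : n * τ = 24 / α * Real.logb 2 (2 * n : ℕ) := by rw [hτ]; field_simp
    rw [hnτ]
    have : 5 * (1 + 4 * β * (24 / α * Real.logb 2 (2 * n : ℕ))) ^ 8 / (2 * n) ≤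
        5 * (1 + 4 * β * (24 / α)) ^ 8 * (Real.logb 2 (2 * n : ℕ) ^ 8 / (2 * n : ℕ)) := by
      calc _ ≤ 5 * ((1 + 4 * β * (24 / α)) * Real.logb 2 (2 * n : ℕ)) ^ 8 / (2 * n) := by
            gcongr
            nlinarith
        _ = _ := by push_cast; ring
    linarith
  · refine (utilityLaw_not_hasGoodMatchings hD hτ0 (by positivity) hp hn).trans ?_
    rw [← ENNReal.ofReal_add (by positivity) (by positivity)]
    refine ENNReal.ofReal_le_ofReal (add_le_add hq ?_)
    set K := 2 * Real.exp 1 * β with hK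
    have hK0 : 0 < K := by positivity
    rcases le_or_gt r n with hrn | hrn
    -- For `r ≤ n`, `τ` is of order `log n / n`, and its third power already beats the `n ^ 2`
    -- pairs.
    · have h1 : Real.logb 2 (r * n : ℕ) ≤ 2 * Real.logb 2 n := by
        calc _ ≤ Real.logb 2 ((n : ℝ) ^ 2) := by
              refine Real.logb_le_logb_of_le one_lt_two (by linarith) ?_
              push_cast
              have : (r : ℝ) ≤ n := by exact_mod_cast hrn
              nlinarith
          _ = _ := by rw [Real.logb_pow]; norm_num
      have h2 : K * τ ≤ 2 * K * (24 / α) * (Real.logb 2 n / n) := by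
        rw [hτ]
        calc _ ≤ K * (24 / α * (2 * Real.logb 2 n / n)) := by gcongr
          _ = _ := by ring
      have : n ^ 2 * (K * τ) ^ r ≤ (2 * K * (24 / α)) ^ 3 * (Real.logb 2 n ^ 3 / n) := by
        calc _ ≤ n ^ 2 * (K * τ) ^ 3 := by
              gcongr n ^ 2 * ?_
              exact pow_le_pow_of_le_one (by positivity) (by linarith) hr3
          _ ≤ n ^ 2 * (2 * K * (24 / α) * (Real.logb 2 n / n)) ^ 3 := by gcongr
          _ = _ := by field_simp
      linarith
    -- For `r > n`, `log m` need not be comparable to `log n`, but `K * τ ≤ 1 / 4` and the exponent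
    -- exceeds `n`.
    · have : n ^ 2 * (K * τ) ^ r ≤ n ^ 2 * (1 / 4 : ℝ) ^ n := by
        calc _ ≤ n ^ 2 * (1 / 4 : ℝ) ^ r := by gcongr
          _ ≤ _ := by
            gcongr n ^ 2 * ?_
            exact pow_le_pow_of_le_one (by norm_num) (by norm_num) hrn.le
      linarith

lemma one_sub_le_measureReal {Ω : Type*} [MeasurableSpace Ω] {μ : Measure Ω}
    [IsProbabilityMeasure μ] {s : Set Ω} {b : ℝ} (hb : 0 ≤ b) (h : μ sᶜ ≤ ENNReal.ofReal b) :
    1 - b ≤ μ.real s := by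
  have h1 : (1 : ℝ) ≤ μ.real s + μ.real sᶜ := by
    have := measureReal_union_le (μ := μ) s sᶜ
    rwa [Set.union_compl_self, probReal_univ] at this
  have h2 : μ.real sᶜ ≤ b := ENNReal.toReal_le_of_le_ofReal hb h
  linarith

instance instIsProbabilityMeasureUtilityLaw {D : Measure ℝ} [IsProbabilityMeasure D] (n m : ℕ) :
    IsProbabilityMeasure (utilityLaw D n m) := by
  unfold utilityLaw; infer_instance

lemma exhaustiveSearch_hasEnvyFreeGuarantee {α β : ℝ} {D : Measure ℝ} [IsProbabilityMeasure D]
    (hD : IsPDFBounded α β D) : HasEnvyFreeGuarantee D (24 / α) (exhaustiveSearch (24 / α)) := by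
  intro m hdvd hm hlog
  set τ : ℕ → ℝ := fun n => 24 / α * (Real.logb 2 (m n) / n) with hτ
  have hτ0 : Tendsto τ atTop (𝓝 0) := by
    simpa using hlog.tendsto_div_nhds_zero.const_mul (24 / α)
  have hτK : Tendsto (fun n => 2 * Real.exp 1 * β * τ n) atTop (𝓝 0) := by
    simpa using hτ0.const_mul (2 * Real.exp 1 * β)
  have hb := tendsto_failureBound α β
  have hlow : Tendsto (fun n => 1 - max (failureBound α β n) 0) atTop (𝓝 1) := by
    simpa using (hb.max (tendsto_const_nhds (x := (0 : ℝ)))).const_sub 1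
  refine tendsto_of_tendsto_of_tendsto_of_le_of_le' hlow tendsto_const_nhds ?_
    (Eventually.of_forall fun n => measureReal_le_one)
  filter_upwards [hdvd, hm, hτ0.eventually_le_const zero_lt_one,
    hτK.eventually_le_const (by norm_num : (0 : ℝ) < 1 / 4), eventually_ge_atTop 1]
    with n h1 h2 h3 h4 hn
  refine one_sub_le_measureReal (le_max_right _ _) ?_
  obtain ⟨r, hr⟩ := h1
  rw [mul_comm] at hr
  have hr2 : 2 ≤ r := by
    rw [hr] at h2
    exact Nat.le_of_mul_le_mul_right h2 hn
  simp only [hτ] at h3 h4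
  generalize m n = k at *
  subst hr
  refine le_trans (measure_mono fun u hu => ?_) ((utilityLaw_not_exists_isGoodEnvyFree hD hn hr2 rfl
    h3 h4).trans (ENNReal.ofReal_le_ofReal (le_max_left _ _)))
  exact fun h => hu (exhaustiveSearch_isGood h)

/-! ### The EFX algorithm: deterministic analysis -/

section Deterministic

variable {n m : ℕ}

/-- The utilities for the first `m / n * n` items. -/
def initialUtilities (u : Utilities n m) : Utilities n (m / n * n) :=
  fun a j => u a (j.castLE (Nat.div_mul_le_self m n))

lemma IsAllocation.card_eq {r : ℕ} {M : Bundles n (r * n)} (hM : IsAllocation M)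
    (hc : ∀ i i', (M i).card = (M i').card) (i : Fin n) : (M i).card = r := by
  have h1 : ∑ i, (M i).card = ∑ j : Fin (r * n), (Finset.univ.filter fun i => j ∈ M i).card := by
    have := Finset.sum_card_bipartiteAbove_eq_sum_card_bipartiteBelow
      (s := (Finset.univ : Finset (Fin n))) (t := (Finset.univ : Finset (Fin (r * n))))
      fun i j => j ∈ M i
    simpa [Finset.bipartiteAbove, Finset.bipartiteBelow] using this
  have h2 : ∀ j, (Finset.univ.filter fun i => j ∈ M i).card = 1 := by
    intro j
    obtain ⟨i, hi, hu⟩ := hM j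
    rw [Finset.card_eq_one]
    refine ⟨i, ?_⟩
    ext k
    simp only [Finset.mem_filter, Finset.mem_univ, true_and, Finset.mem_singleton]
    exact ⟨hu k, fun h => h ▸ hi⟩
  simp only [h2, hc _ i] at h1
  simp only [Finset.sum_const, Finset.card_univ, Fintype.card_fin, smul_eq_mul, mul_one] at h1
  have hn : 0 < n := i.pos
  exact Nat.eq_of_mul_eq_mul_left hn (by rw [h1, mul_comm])

lemma mem_efxViaEF_iff {A : AllocationAlgorithm} {σ : Equiv.Perm (Fin (m % n))}
    {u : Utilities n m} {i : Fin n} {j : Fin m} :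
    j ∈ efxViaEF A n m σ u i ↔
      (∃ k ∈ A.run n (m / n * n) (initialUtilities u) i,
        k.castLE (Nat.div_mul_le_self m n) = j) ∨
      ∃ k : Fin (m % n), (i : ℕ) = n - m % n + k ∧ (j : ℕ) = m / n * n + σ k := by
  have hmod : m % n < n := Nat.mod_lt m i.pos
  unfold efxViaEF
  rw [Finset.mem_union]
  refine or_congr (by rw [Finset.mem_map]; exact Iff.rfl) ?_
  split_ifs with h
  · rw [Finset.mem_singleton, Fin.ext_iff]
    constructor
    · exact fun hj => ⟨⟨i - (n - m % n), by omega⟩, by simp only; omega, hj⟩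
    · rintro ⟨k, hk, hj⟩
      have : (⟨i - (n - m % n), by omega⟩ : Fin (m % n)) = k := Fin.ext (by simp only; omega)
      simp only [this]
      exact hj
  · simp only [Finset.notMem_empty, false_iff, not_exists, not_and]
    intro k hk
    omega

lemma isAllocation_efxViaEF {A : AllocationAlgorithm} (σ : Equiv.Perm (Fin (m % n)))
    {u : Utilities n m} (hn : 0 < n)
    (h : IsAllocation (A.run n (m / n * n) (initialUtilities u))) :
    IsAllocation (efxViaEF A n m σ u) := by
  have hdm := Nat.div_add_mod' m n
  have hmod := Nat.mod_lt m hn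
  intro j
  rcases lt_or_ge (j : ℕ) (m / n * n) with hj | hj
  · obtain ⟨i, hi, hu⟩ := h ⟨j, hj⟩
    refine ⟨i, mem_efxViaEF_iff.2 (.inl ⟨_, hi, rfl⟩), fun i' hi' => ?_⟩
    rcases mem_efxViaEF_iff.1 hi' with ⟨k, hk, hkj⟩ | ⟨k, -, hk⟩
    · have hkj' : (⟨j, hj⟩ : Fin (m / n * n)) = k := Fin.ext (by simp only [← hkj]; rfl)
      refine hu i' ?_
      rw [hkj']
      exact hk
    · omega
  · have hk : (j : ℕ) - m / n * n < m % n := by have := j.isLt; omega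
    set k : Fin (m % n) := σ.symm ⟨j - m / n * n, hk⟩ with hkdef
    have hσk : (σ k : ℕ) = j - m / n * n := by rw [hkdef, Equiv.apply_symm_apply]
    refine ⟨⟨n - m % n + k, by have := k.isLt; omega⟩,
      mem_efxViaEF_iff.2 (.inr ⟨k, rfl, by omega⟩), fun i' hi' => ?_⟩
    rcases mem_efxViaEF_iff.1 hi' with ⟨k', hk', hkj⟩ | ⟨k', hk', hj'⟩
    · have := k'.isLt
      have h2 := congrArg Fin.val hkj
      simp only [Fin.val_castLE] at h2
      omega
    · have : σ k' = σ k := Fin.ext (by omega)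
      obtain rfl := σ.injective this
      exact Fin.ext hk'

/-- Agent `i` may envy agent `i'` after the leftover items are handed out: one of the items of
the bundle of `i'` and one of the leftover items are valued at least `1 - y` by `i`. -/
def MayEnvy (M : Bundles n (m / n * n)) (u : Utilities n m) (y : ℝ) (i i' : Fin n) : Prop :=
  (∃ j ∈ M i', 1 - y ≤ initialUtilities u i j) ∧ ∃ j : Fin m, m / n * n ≤ j ∧ 1 - y ≤ u i j

/-- If the reduced bundle has only original items, envy-freeness of the initial allocation suffices.
Otherwise it consists of `r` items, including the leftover one. Envy makes their total exceed `r *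
(1 - δ)`, and since the other `r - 1` are worth at most one each, every one of them is worth at
least `1 - r * δ`. -/
lemma isEFX_efxViaEF {A : AllocationAlgorithm} (σ : Equiv.Perm (Fin (m % n)))
    {u : Utilities n m} (hr : 2 ≤ m / n) (hu : ∀ i j, u i j ∈ Set.Icc (0 : ℝ) 1) {C δ : ℝ}
    (hgood : IsGoodEnvyFree C (initialUtilities u) (A.run n (m / n * n) (initialUtilities u)))
    (hδ : C * (Real.logb 2 (m / n * n : ℕ) / n) ≤ δ)
    (henvy : ∀ i i' : Fin n, n - m % n ≤ i' →
      ¬ MayEnvy (A.run n (m / n * n) (initialUtilities u)) u ((m / n : ℕ) * δ) i i') :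
    IsEFX u (efxViaEF A n m σ u) := by
  classical
  set r := m / n with hrdef
  set M := A.run n (m / n * n) (initialUtilities u) with hM
  obtain ⟨hall, hef, hcard, hval⟩ := hgood
  set c : Fin (m / n * n) ↪ Fin m := Fin.castLEEmb (Nat.div_mul_le_self m n) with hc
  have hcardr : ∀ i, (M i).card = r := hall.card_eq hcard
  have hmap : ∀ i i', bundleValue u i ((M i').map c) = bundleValue (initialUtilities u) i (M i') :=
    fun i i' => by rw [bundleValue, Finset.sum_map]; rfl
  have hsub : ∀ i, (M i).map c ⊆ efxViaEF A n m σ u i := fun i => Finset.subset_union_left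
  have hmono : ∀ i (S T : Finset (Fin m)), S ⊆ T → bundleValue u i S ≤ bundleValue u i T :=
    fun i S T h => Finset.sum_le_sum_of_subset_of_nonneg h fun j _ _ => (hu i j).1
  intro i i' j hj
  have hi := (hmap i i).symm.le.trans (hmono i _ _ (hsub i))
  by_cases hsmall : (efxViaEF A n m σ u i').erase j ⊆ (M i').map c
  · exact (hmono i _ _ hsmall).trans ((hmap i i').le.trans ((hef i i').trans hi))
  obtain ⟨l, hl, hlM⟩ := Finset.not_subset.1 hsmall
  obtain ⟨hlj, hl⟩ := Finset.mem_erase.1 hl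
  rcases mem_efxViaEF_iff.1 hl with ⟨k, hk, hkl⟩ | ⟨k, hk, hlk⟩
  · exact absurd (Finset.mem_map.2 ⟨k, hk, hkl⟩) hlM
  have hbundle : efxViaEF A n m σ u i' = insert l ((M i').map c) := by
    ext x
    rw [mem_efxViaEF_iff, Finset.mem_insert, or_comm]
    refine or_congr ⟨?_, ?_⟩ ?_
    · rintro ⟨k', hk', hx⟩
      obtain rfl : k' = k := Fin.ext (by omega)
      exact Fin.ext (hx.trans hlk.symm)
    · rintro rfl
      exact ⟨k, hk, hlk⟩
    · rw [Finset.mem_map]; rfl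
  by_contra! hlt
  have hcardS : ((efxViaEF A n m σ u i').erase j).card = r := by
    rw [Finset.card_erase_of_mem hj, hbundle, Finset.card_insert_of_notMem hlM,
      Finset.card_map, hcardr, Nat.add_sub_cancel]
  have hown : (r : ℝ) * (1 - δ) ≤ bundleValue (initialUtilities u) i (M i) := by
    calc (r : ℝ) * (1 - δ) = ∑ k ∈ M i, (1 - δ) := by
          rw [Finset.sum_const, hcardr, nsmul_eq_mul]
      _ ≤ _ := Finset.sum_le_sum fun k hk => by linarith [hval i k hk]
  have hlarge : ∀ x ∈ (efxViaEF A n m σ u i').erase j, 1 - r * δ ≤ u i x := by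
    intro x hx
    have h1 : bundleValue u i ((efxViaEF A n m σ u i').erase j) ≤ u i x + (r - 1) := by
      rw [bundleValue, ← Finset.add_sum_erase _ _ hx]
      gcongr
      calc _ ≤ ∑ k ∈ ((efxViaEF A n m σ u i').erase j).erase x, (1 : ℝ) :=
            Finset.sum_le_sum fun k _ => (hu i k).2
        _ = _ := by
            rw [Finset.sum_const, Finset.card_erase_of_mem hx, hcardS, nsmul_eq_mul, mul_one,
              Nat.cast_sub (by omega), Nat.cast_one]
    linarith
  refine henvy i i' (by omega) ⟨?_, l, by omega, hlarge l (Finset.mem_erase.2 ⟨hlj, hl⟩)⟩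
  -- Here `r ≥ 2` is essential: an original item survives the removal of `j`.
  have : ∃ x ∈ (M i').map c, x ≠ j :=
    Finset.exists_mem_ne (by rw [Finset.card_map, hcardr]; omega) j
  obtain ⟨x, hx, hxj⟩ := this
  have h2 := hlarge x (Finset.mem_erase.2 ⟨hxj, hsub i' hx⟩)
  obtain ⟨k, hk, rfl⟩ := Finset.mem_map.1 hx
  exact ⟨k, hk, h2⟩

end Deterministic

/-! ### The EFX algorithm: probabilistic analysis -/

section Probabilistic

variable {α β : ℝ} {D : Measure ℝ} [IsProbabilityMeasure D]

/-- Agent `i` values an item in the bundle of `i'` at least `1 - y`, all the bundles have `r` items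
and every item is valued at least `1 - y` by at most `d` agents. -/
def IsNearEnvy (A : AllocationAlgorithm) {n k : ℕ} (r : ℕ) (y d : ℝ) (x : Utilities n k)
    (i i' : Fin n) : Prop :=
  (A.run n k x i').card = r ∧
    (∀ j, ((Finset.univ.filter fun a => 1 - y ≤ x a j).card : ℝ) ≤ d) ∧
      ∃ j ∈ A.run n k x i', 1 - y ≤ x i j

lemma measurableSet_isNearEnvy (A : AllocationAlgorithm) {n k : ℕ} (r : ℕ) (y d : ℝ)
    (i i' : Fin n) : MeasurableSet {x : Utilities n k | IsNearEnvy A r y d x i i'} := by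
  have hnear : ∀ (a : Fin n) (j : Fin k), MeasurableSet {x : Utilities n k | 1 - y ≤ x a j} :=
    fun a j => measurableSet_le measurable_const (measurable_cell a j)
  have e : {x : Utilities n k | IsNearEnvy A r y d x i i'} = ⋃ M : Bundles n k,
      {x | A.run n k x = M} ∩ {x | (M i').card = r ∧
        (∀ j, ((Finset.univ.filter fun a => 1 - y ≤ x a j).card : ℝ) ≤ d) ∧
          ∃ j ∈ M i', 1 - y ≤ x i j} := by
    ext x
    simp [IsNearEnvy]
  rw [e]
  refine MeasurableSet.iUnion fun M => (A.measurableSet_run_eq n k M).inter ?_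
  have h1 : MeasurableSet {x : Utilities n k |
      ∀ j, ((Finset.univ.filter fun a => 1 - y ≤ x a j).card : ℝ) ≤ d} := by
    simp only [Set.ofPred_forall]
    refine MeasurableSet.iInter fun j => measurableSet_le ?_ measurable_const
    refine (measurable_of_countable fun k : ℕ => (k : ℝ)).comp ?_
    simp only [Finset.card_filter]
    exact Finset.measurable_sum _ fun a _ =>
      Measurable.ite (hnear a j) measurable_const measurable_const
  have h2 : MeasurableSet {x : Utilities n k | ∃ j ∈ M i', 1 - y ≤ x i j} := by
    have : {x : Utilities n k | ∃ j ∈ M i', 1 - y ≤ x i j} =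
        ⋃ j ∈ M i', {x : Utilities n k | 1 - y ≤ x i j} := by
      ext x; simp
    rw [this]
    exact (M i').measurableSet_biUnion fun j _ => hnear i j
  exact (MeasurableSet.const _).inter (h1.inter h2)

/-- The allocation depends on the utilities, so no independence is available. The bound is instead
pointwise: the bundle has `r` items and each interests at most `d` agents, hence the sum is the
expectation of a count never exceeding `r * d`. -/
lemma sum_measure_isNearEnvy_le (A : AllocationAlgorithm) {n k : ℕ} (r : ℕ) (y d : ℝ)
    (i' : Fin n) (μ : Measure (Utilities n k)) [IsProbabilityMeasure μ] :
    ∑ i, μ {x | IsNearEnvy A r y d x i i'} ≤ ENNReal.ofReal (r * d) := by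
  classical
  calc _ = ∑ i, ∫⁻ x, {x | IsNearEnvy A r y d x i i'}.indicator 1 x ∂μ :=
        Finset.sum_congr rfl fun i _ =>
          (lintegral_indicator_one (measurableSet_isNearEnvy A r y d i i')).symm
    _ = ∫⁻ x, ∑ i, {x | IsNearEnvy A r y d x i i'}.indicator 1 x ∂μ :=
        (lintegral_finsetSum _ fun i _ =>
          measurable_one.indicator (measurableSet_isNearEnvy A r y d i i')).symm
    _ ≤ ∫⁻ _, ENNReal.ofReal (r * d) ∂μ := by
        refine lintegral_mono fun x => ?_
        have e : ∑ i, {x | IsNearEnvy A r y d x i i'}.indicator (1 : Utilities n k → ℝ≥0∞) x =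
            ((Finset.univ.filter fun i => IsNearEnvy A r y d x i i').card : ℝ≥0∞) := by
          simp [Set.indicator_apply]
        rw [e]
        by_cases hex : ∃ i, IsNearEnvy A r y d x i i'
        · obtain ⟨i, hcard, hd, -⟩ := hex
          rw [← ENNReal.ofReal_natCast]
          refine ENNReal.ofReal_le_ofReal ?_
          have hsub : (Finset.univ.filter fun i => IsNearEnvy A r y d x i i') ⊆
              (A.run n k x i').biUnion fun j => Finset.univ.filter fun a => 1 - y ≤ x a j := by
            intro a ha
            obtain ⟨-, -, j, hj, hja⟩ := (Finset.mem_filter.1 ha).2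
            exact Finset.mem_biUnion.2 ⟨j, hj, by simpa using hja⟩
          calc _ ≤ ((∑ j ∈ A.run n k x i',
                (Finset.univ.filter fun a => 1 - y ≤ x a j).card : ℕ) : ℝ) := by
                exact_mod_cast (Finset.card_le_card hsub).trans Finset.card_biUnion_le
            _ ≤ ∑ j ∈ A.run n k x i', d := by
                push_cast
                exact Finset.sum_le_sum fun j _ => hd j
            _ = r * d := by rw [Finset.sum_const, hcard, nsmul_eq_mul]
        · push Not at hex
          simp [hex]
    _ = _ := by simp

lemma utilityLaw_popular_item (hD : IsPDFBounded α β D) {n k : ℕ} {y : ℝ} (hy : 0 ≤ y)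
    (d : ℝ) :
    utilityLaw D n k
      {x | ¬ ∀ j, ((Finset.univ.filter fun a => 1 - y ≤ x a j).card : ℝ) ≤ d} ≤
      ENNReal.ofReal (k * Real.exp (2 * (β * y) * n - d)) := by
  classical
  have hp : D.real (Set.Ici (1 - y)) ≤ β * y :=
    ENNReal.toReal_le_of_le_ofReal (mul_nonneg hD.2.1.le hy) (hD.apply_Ici_le y)
  calc _ ≤ utilityLaw D n k (⋃ j : Fin k,
          {x | d ≤ (((Finset.univ : Finset (Fin n)) ×ˢ {j}).filter
            fun c => x c.1 c.2 ∈ Set.Ici (1 - y)).card}) := by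
        refine measure_mono fun x hx => ?_
        simp only [Set.mem_ofPred_eq, not_forall, not_le] at hx
        obtain ⟨j, hj⟩ := hx
        refine Set.mem_iUnion.2 ⟨j, hj.le.trans ?_⟩
        refine Nat.cast_le.2 (Finset.card_le_card_of_injOn (fun a => (a, j)) (fun a ha => ?_)
          fun a _ b _ h => (Prod.ext_iff.1 h).1)
        simpa using ha
    _ ≤ ∑ j : Fin k, ENNReal.ofReal (Real.exp (2 * (β * y) * n - d)) := by
        refine (measure_iUnion_fintype_le _ _).trans (Finset.sum_le_sum fun j _ => ?_)
        refine (cellLaw_le_card (D := D) measurableSet_Ici _ hp d).trans_eq ?_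
        rw [Finset.card_product, Finset.card_singleton, mul_one, Finset.card_univ,
          Fintype.card_fin]
    _ = _ := by
        rw [Finset.sum_const, Finset.card_univ, Fintype.card_fin, ← ENNReal.ofReal_nsmul,
          nsmul_eq_mul]

lemma cellLaw_row_exists (hD : IsPDFBounded α β D) {n q : ℕ} (y : ℝ) (i : Fin n) :
    cellLaw D (Fin n) (Fin q) {w | ∃ k, 1 - y ≤ w i k} ≤ ENNReal.ofReal (q * (β * y)) := by
  calc _ ≤ cellLaw D (Fin n) (Fin q) (⋃ k, {w | ∀ x ∈ ({(i, k)} : Finset (Fin n × Fin q)),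
          w x.1 x.2 ∈ Set.Ici (1 - y)}) := by
        refine measure_mono fun w hw => ?_
        obtain ⟨k, hk⟩ := hw
        exact Set.mem_iUnion.2 ⟨k, by simpa using hk⟩
    _ ≤ ∑ k : Fin q, ENNReal.ofReal (β * y) := by
        refine (measure_iUnion_fintype_le _ _).trans (Finset.sum_le_sum fun k _ => ?_)
        rw [cellLaw_forall_mem, Finset.card_singleton, pow_one]
        exact hD.apply_Ici_le y
    _ = _ := by
        rw [Finset.sum_const, Finset.card_univ, Fintype.card_fin, ← ENNReal.ofReal_nsmul,
          nsmul_eq_mul]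

lemma card_lucky_agents_le (n q : ℕ) :
    (Finset.univ.filter fun i : Fin n => n - q ≤ (i : ℕ)).card ≤ q := by
  refine (Finset.card_le_card_of_injOn (t := Finset.range q) (fun i : Fin n => (i : ℕ) - (n - q))
    (fun i hi => ?_) fun i hi j hj h => ?_).trans_eq (Finset.card_range q)
  · have := (Finset.mem_filter.1 hi).2
    have h2 := i.isLt
    simp only [Finset.coe_range, Set.mem_Iio]
    omega
  · have h1 := (Finset.mem_filter.1 hi).2
    have h2 := (Finset.mem_filter.1 hj).2
    simp only at h
    exact Fin.ext (by omega)

/-- Near-envy depends only on the first `m / n * n` columns and interest in a leftover item only on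
the others, so the probabilities multiply. The first factor is summed over `i` before the union
bound over the receivers `i'`, which avoids a factor `n`. -/
lemma utilityLaw_nearEnvy (hD : IsPDFBounded α β D) (A : AllocationAlgorithm) {n m : ℕ} (r : ℕ)
    {y d : ℝ} (hy : 0 ≤ y) (hd : 0 ≤ d) :
    utilityLaw D n m {u | ∃ i i' : Fin n, n - m % n ≤ i' ∧
        IsNearEnvy A r y d (initialUtilities u) i i' ∧
          ∃ j : Fin m, m / n * n ≤ j ∧ 1 - y ≤ u i j} ≤
      ENNReal.ofReal ((m % n : ℕ) * (r * d * ((m % n : ℕ) * (β * y)))) := by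
  classical
  have hβ : 0 ≤ β := hD.2.1.le
  have hdm : m / n * n + m % n = m := Nat.div_add_mod' m n
  set e : Fin m ≃ Fin (m / n * n) ⊕ Fin (m % n) :=
    (finCongr hdm.symm).trans finSumFinEquiv.symm with he
  have heinl : ∀ j : Fin (m / n * n), e (j.castLE (Nat.div_mul_le_self m n)) = .inl j := by
    intro j
    rw [he, Equiv.trans_apply, Equiv.symm_apply_eq]
    exact Fin.ext rfl
  have heinr : ∀ j : Fin m, m / n * n ≤ j → ∃ k, e j = .inr k := by
    intro j hj
    refine ⟨⟨j - m / n * n, by have := j.isLt; omega⟩, ?_⟩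
    rw [he, Equiv.trans_apply, Equiv.symm_apply_eq]
    refine Fin.ext ?_
    simp [hj]
  have hmp := measurePreserving_glue (D := D) (I := Fin n) e
  have hinv : MeasurePreserving (fun u : Utilities n m =>
      ((fun i k => u i (e.symm (.inl k)), fun i k => u i (e.symm (.inr k))) :
        (Fin n → Fin (m / n * n) → ℝ) × (Fin n → Fin (m % n) → ℝ))) (cellLaw D (Fin n) (Fin m))
      ((cellLaw D (Fin n) (Fin (m / n * n))).prod (cellLaw D (Fin n) (Fin (m % n)))) := by
    have hmeas : Measurable (fun u : Utilities n m =>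
      ((fun i k => u i (e.symm (.inl k)), fun i k => u i (e.symm (.inr k))) :
        (Fin n → Fin (m / n * n) → ℝ) × (Fin n → Fin (m % n) → ℝ))) :=
      (measurable_cells fun i j => measurable_cell _ _).prodMk
        (measurable_cells fun i j => measurable_cell _ _)
    refine ⟨hmeas, ?_⟩
    rw [← hmp.map_eq, Measure.map_map hmeas hmp.measurable]
    convert Measure.map_id
    ext v i k <;> simp
  set B : Fin n → Fin n → Set ((Fin n → Fin (m / n * n) → ℝ) × (Fin n → Fin (m % n) → ℝ)) :=
    fun i' i => {x | IsNearEnvy A r y d x i i'} ×ˢ {w | ∃ k, 1 - y ≤ w i k} with hB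
  calc _ ≤ ((cellLaw D (Fin n) (Fin (m / n * n))).prod (cellLaw D (Fin n) (Fin (m % n))))
          (⋃ i' ∈ Finset.univ.filter fun i : Fin n => n - m % n ≤ (i : ℕ), ⋃ i, B i' i) := by
        refine measure_le_of_measurePreserving hinv fun u hu => ?_
        obtain ⟨i, i', hi', hx, j, hj, hw⟩ := hu
        simp only [Set.mem_iUnion]
        refine ⟨i', by simpa using hi', i, ?_, ?_⟩
        · have : (fun i k => u i (e.symm (.inl k))) = initialUtilities u := by
            funext i k
            rw [initialUtilities, ← heinl, Equiv.symm_apply_apply]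
          exact this ▸ hx
        · obtain ⟨k, hk⟩ := heinr j hj
          refine ⟨k, ?_⟩
          simpa [← hk] using hw
    _ ≤ ∑ i' ∈ Finset.univ.filter fun i : Fin n => n - m % n ≤ (i : ℕ),
          ENNReal.ofReal (r * d * ((m % n : ℕ) * (β * y))) := by
        refine (measure_biUnion_finset_le _ _).trans (Finset.sum_le_sum fun i' _ => ?_)
        refine (measure_iUnion_fintype_le _ _).trans ?_
        calc _ ≤ ∑ i, cellLaw D (Fin n) (Fin (m / n * n)) {x | IsNearEnvy A r y d x i i'} *
              ENNReal.ofReal ((m % n : ℕ) * (β * y)) := by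
              refine Finset.sum_le_sum fun i _ => ?_
              rw [hB, Measure.prod_prod]
              gcongr
              exact cellLaw_row_exists hD y i
          _ ≤ ENNReal.ofReal (r * d) * ENNReal.ofReal ((m % n : ℕ) * (β * y)) := by
              rw [← Finset.sum_mul]
              gcongr
              exact sum_measure_isNearEnvy_le A r y d i' _
          _ = _ := by rw [← ENNReal.ofReal_mul (by positivity)]
    _ ≤ _ := by
        rw [Finset.sum_const, ← ENNReal.ofReal_nsmul, nsmul_eq_mul]
        refine ENNReal.ofReal_le_ofReal ?_
        gcongr
        exact card_lucky_agents_le n (m % n)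

/-- The failure probability of the EFX algorithm. -/
lemma utilityLaw_not_efx_le (hD : IsPDFBounded α β D) (A : AllocationAlgorithm) {n m : ℕ}
    (hn : 1 ≤ n) (hr : 2 ≤ m / n) {C C₁ : ℝ} (hC : C ≤ C₁) (hC₁ : 0 ≤ C₁) :
    (utilityLaw D n m) {u | ∀ σ : Equiv.Perm (Fin (m % n)),
        IsAllocation (efxViaEF A n m σ u) ∧ IsEFX u (efxViaEF A n m σ u)}ᶜ ≤
      utilityLaw D n (m / n * n) {x | IsGoodEnvyFree C x (A.run n (m / n * n) x)}ᶜ +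
        ENNReal.ofReal (1 / n + β * C₁ * (2 * β * C₁ + 2) *
          (((m % n : ℕ) : ℝ) ^ 2 * ((m / n : ℕ) : ℝ) ^ 3 * Real.logb 2 m ^ 3 / n)) := by
  have hβ : 0 ≤ β := hD.2.1.le
  set r := m / n with hrdef
  set q := m % n with hq
  have hn' : (1 : ℝ) ≤ n := by exact_mod_cast hn
  have hr' : (2 : ℝ) ≤ r := by exact_mod_cast hr
  have hrn : (2 : ℝ) ≤ (r * n : ℕ) := by push_cast; nlinarith
  have hle : r * n ≤ m := Nat.div_mul_le_self m n
  have hle' : ((r * n : ℕ) : ℝ) ≤ m := by exact_mod_cast hle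
  set L' := Real.logb 2 (r * n : ℕ) with hL'
  set L := Real.logb 2 m with hL
  have hLL : L' ≤ L := Real.logb_le_logb_of_le one_lt_two (by linarith) hle'
  have hL'1 : 1 ≤ L' := by
    rw [hL', Real.le_logb_iff_rpow_le one_lt_two (by linarith)]; simpa using hrn
  have hL1 : 1 ≤ L := hL'1.trans hLL
  set δ := C₁ * (L' / n) with hδ
  have hδ0 : 0 ≤ δ := by positivity
  set y := (r : ℝ) * δ with hy
  have hy0 : 0 ≤ y := by positivity
  -- The first term cancels the mean in Chernoff's bound; the second leaves `exp (-2 * L')`, at most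
  -- `(r * n) ^ (-2)`, which survives the union over `r * n` items.
  set d := 2 * (β * y) * n + 2 * L' with hd
  have hd0 : 0 ≤ d := by positivity
  have hyn : y * n = r * (C₁ * L') := by rw [hy, hδ]; field_simp
  have hpop : utilityLaw D n m {u | ¬ ∀ j : Fin (r * n),
      ((Finset.univ.filter fun a => 1 - y ≤ initialUtilities u a j).card : ℝ) ≤ d} ≤
      ENNReal.ofReal (1 / n) := by
    have hmp := measurePreserving_columns (D := D) (I := Fin n)
      (e := fun j : Fin (m / n * n) => j.castLE (Nat.div_mul_le_self m n))
      (Fin.castLE_injective _)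
    refine (measure_le_of_measurePreserving hmp
      (t := {x | ¬ ∀ j, ((Finset.univ.filter fun a => 1 - y ≤ x a j).card : ℝ) ≤ d})
      fun u hu => hu).trans ((utilityLaw_popular_item hD hy0 d).trans
        (ENNReal.ofReal_le_ofReal ?_))
    have hlog := log_le_logb_two (by linarith : (1 : ℝ) ≤ (r * n : ℕ))
    calc _ = ((r * n : ℕ) : ℝ) * Real.exp (-(2 * L')) := by rw [hd]; congr 2; ring
      _ ≤ ((r * n : ℕ) : ℝ) * Real.exp (-(2 * Real.log (r * n : ℕ))) := by gcongr
      _ = ((r * n : ℕ) : ℝ)⁻¹ := by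
          rw [Real.exp_neg, two_mul, Real.exp_add, Real.exp_log (by linarith)]
          field_simp
      _ ≤ (n : ℝ)⁻¹ := by
          gcongr
          nlinarith
      _ = 1 / n := (one_div _).symm
  have hnear := utilityLaw_nearEnvy hD A (n := n) (m := m) r hy0 hd0
  have hgood : utilityLaw D n m {u | IsGoodEnvyFree C (initialUtilities u)
      (A.run n (m / n * n) (initialUtilities u))}ᶜ ≤
      utilityLaw D n (m / n * n) {x | IsGoodEnvyFree C x (A.run n (m / n * n) x)}ᶜ :=
    measure_le_of_measurePreserving (measurePreserving_columns (D := D) (I := Fin n)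
      (e := fun j : Fin (m / n * n) => j.castLE (Nat.div_mul_le_self m n))
      (Fin.castLE_injective _)) fun u hu => hu
  have hunit : utilityLaw D n m {u | ∀ i j, u i j ∈ Set.Icc (0 : ℝ) 1}ᶜ ≤ 0 :=
    (cellLaw_unit hD (Fin n) (Fin m)).le
  refine (measure_mono fun u hu => ?_).trans (((measure_union_le _ _).trans (add_le_add hgood
    ((measure_union_le _ _).trans (add_le_add hpop ((measure_union_le _ _).trans
      (add_le_add hnear hunit)))))).trans ?_)
  · by_contra hcon
    simp only [Set.mem_union, Set.mem_compl_iff, Set.mem_ofPred_eq, not_or, not_not] at hcon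
    obtain ⟨h1, h2, h3, h4⟩ := hcon
    refine hu fun σ => ⟨isAllocation_efxViaEF σ hn h1.1,
      isEFX_efxViaEF σ hr h4 h1 (δ := δ) ?_ fun i i' hi' hmay => h3 ⟨i, i', hi', ?_, hmay.2⟩⟩
    · rw [hδ]
      gcongr
    · exact ⟨h1.1.card_eq h1.2.2.1 i', h2, hmay.1⟩
  · rw [add_zero, ← ENNReal.ofReal_add (by positivity) (by positivity)]
    refine add_le_add le_rfl (ENNReal.ofReal_le_ofReal (add_le_add le_rfl ?_))
    have hd2 : d ≤ (2 * β * C₁ + 2) * (r * L) := by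
      have : d = 2 * β * C₁ * (r * L') + 2 * L' := by
        rw [hd, show 2 * (β * y) * n = 2 * β * (y * n) by ring, hyn]; ring
      have h1 : r * L' ≤ r * L := by gcongr
      have h2 : L' ≤ r * L := by nlinarith
      have h3 : 0 ≤ 2 * β * C₁ := by positivity
      nlinarith [mul_le_mul_of_nonneg_left h1 h3]
    have hy2 : y ≤ r * (C₁ * L) / n := by
      rw [le_div_iff₀ (by linarith), hyn]
      gcongr
    calc (q : ℝ) * (r * d * (q * (β * y))) ≤
          q * (r * ((2 * β * C₁ + 2) * (r * L)) * (q * (β * (r * (C₁ * L) / n)))) := by gcongr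
      _ = β * C₁ * (2 * β * C₁ + 2) * (q ^ 2 * r ^ 3 * L ^ 2 / n) := by ring
      _ ≤ β * C₁ * (2 * β * C₁ + 2) * (q ^ 2 * r ^ 3 * L ^ 3 / n) := by
          have hLp : L ^ 2 ≤ L ^ 3 := pow_le_pow_right₀ hL1 (by norm_num)
          gcongr

end Probabilistic

/-! ### From a single instance to sequences of instances -/

/-- Keep only the first `m / n * n` items if the claimed bound is not trivial, and `2 * n` items
otherwise: a sequence to which the guarantee applies. -/
lemma exists_admissible_sequence {X : ℕ → ℝ} {m : ℕ → ℕ} (hm : ∀ᶠ n in atTop, 2 ≤ m n / n)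
    (hlog : (fun n : ℕ => Real.logb 2 (m n)) =o[atTop ⊓ 𝓟 {n : ℕ | n ∣ m n}]
      fun n : ℕ => (n : ℝ))
    (hX : ∀ᶠ n in atTop, ¬ n ∣ m n → Real.logb 2 (m n) ^ 3 / n ≤ X n) :
    ∃ k : ℕ → ℕ, (∀ᶠ n in atTop, n ∣ k n) ∧ (∀ᶠ n in atTop, 2 * n ≤ k n) ∧
      ((fun n : ℕ => Real.logb 2 (k n)) =o[atTop] fun n : ℕ => (n : ℝ)) ∧
      ∀ n, k n = m n / n * n ∨ 1 ≤ X n := by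
  classical
  refine ⟨fun n => if n ∣ m n ∨ X n < 1 then m n / n * n else 2 * n, ?_, ?_, ?_, fun n => ?_⟩
  · refine Eventually.of_forall fun n => ?_
    dsimp only
    split_ifs
    · exact dvd_mul_left _ _
    · exact dvd_mul_left _ _
  · filter_upwards [hm] with n hn
    split_ifs
    · exact Nat.mul_le_mul_right n hn
    · exact le_rfl
  · rw [isLittleO_iff]
    intro c hc
    have h1 := isLittleO_iff.1 hlog hc
    rw [eventually_inf_principal] at h1
    have h2 : Tendsto (fun n : ℕ => Real.logb 2 (2 * n : ℕ) ^ 1 / (2 * n : ℕ)) atTop (𝓝 0) :=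
      (tendsto_logb_pow_div 1).comp (tendsto_id.const_mul_atTop' (two_pos : 0 < 2))
    have h3 : ∀ᶠ n : ℕ in atTop, 1 ≤ c ^ 3 * (n : ℝ) ^ 2 := by
      have : Tendsto (fun n : ℕ => c ^ 3 * (n : ℝ) ^ 2) atTop atTop :=
        ((tendsto_pow_atTop two_ne_zero).comp tendsto_natCast_atTop_atTop).const_mul_atTop
          (by positivity)
      exact this.eventually_ge_atTop 1
    filter_upwards [h1, h2.eventually_le_const (half_pos hc), h3, hX, hm, eventually_ge_atTop 1]
      with n g1 g2 g3 g4 g5 hn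
    have hn' : (1 : ℝ) ≤ n := by exact_mod_cast hn
    have hlogs : ∀ {a : ℕ}, 1 ≤ a → 0 ≤ Real.logb 2 (a : ℝ) := fun h =>
      Real.logb_nonneg one_lt_two (by exact_mod_cast h)
    rw [Real.norm_natCast]
    split_ifs with h
    · by_cases hd : n ∣ m n
      · rw [Nat.div_mul_cancel hd]
        simpa using g1 hd
      -- A nontrivial bound with `q ≥ 1` forces `log ^ 3 m < n`, hence `log m = o(n)` without a
      -- separate assumption.
      · have hlt := (g4 hd).trans_lt (h.resolve_left hd)
        have hpos : 1 ≤ m n / n * n := Nat.mul_pos (by omega) hn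
        have hle : m n / n * n ≤ m n := Nat.div_mul_le_self _ _
        rw [Real.norm_of_nonneg (hlogs hpos)]
        have hmono : Real.logb 2 (m n / n * n : ℕ) ≤ Real.logb 2 (m n) :=
          Real.logb_le_logb_of_le one_lt_two (by exact_mod_cast hpos) (by exact_mod_cast hle)
        refine hmono.trans ?_
        by_contra! hcon
        rw [div_lt_one (by linarith)] at hlt
        have h5 : (c * n) ^ 3 < n := (pow_lt_pow_left₀ hcon (by positivity) (by norm_num)).trans hlt
        have h6 : (1 : ℝ) * n ≤ c ^ 3 * n ^ 2 * n := by gcongr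
        nlinarith
    · have h0 : 1 ≤ 2 * n := by omega
      rw [Real.norm_of_nonneg (hlogs h0)]
      rw [pow_one, div_le_iff₀ (by positivity)] at g2
      push_cast at g2 ⊢
      linarith
  · dsimp only
    split_ifs with h
    · exact .inl rfl
    · push Not at h
      exact .inr h.2

/-- The guarantee is applied to the modified sequence `k`. Where `k n = m n / n * n` it controls the
failure of the subroutine; at the other `n` the claimed lower bound is already nonpositive up to the
error term. -/
theorem efx_of_hasEnvyFreeGuarantee {α β : ℝ} (C₀ : ℝ) :
    ∃ C : ℝ, ∀ D : Measure ℝ, IsProbabilityMeasure D → IsPDFBounded α β D →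
      ∀ A : AllocationAlgorithm, HasEnvyFreeGuarantee D C₀ A →
      ∀ m : ℕ → ℕ, (∀ᶠ n in atTop, 2 ≤ m n / n) →
        ((fun n : ℕ => Real.logb 2 (m n)) =o[atTop ⊓ 𝓟 {n : ℕ | n ∣ m n}]
          fun n : ℕ => (n : ℝ)) →
        ∃ ε : ℕ → ℝ, Tendsto ε atTop (𝓝 0) ∧ ∀ᶠ n in atTop,
          1 - ε n - C * (((m n % n : ℕ) : ℝ) ^ 2 * ((m n / n : ℕ) : ℝ) ^ 3 *
              Real.logb 2 (m n) ^ 3 / n) ≤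
            (utilityLaw D n (m n)).real
              {u | ∀ σ : Equiv.Perm (Fin (m n % n)),
                IsAllocation (efxViaEF A n (m n) σ u) ∧ IsEFX u (efxViaEF A n (m n) σ u)} := by
  set C₁ := max C₀ 0 with hC₁
  -- The maximum with one ensures that `C * Y n` dominates `log ^ 3 m / n` whenever there are
  -- leftover items, as the choice of `k` requires.
  set C := max 1 (β * C₁ * (2 * β * C₁ + 2)) with hC
  refine ⟨C, fun D _ hD A hA m hm hlog => ?_⟩
  set Y : ℕ → ℝ := fun n => ((m n % n : ℕ) : ℝ) ^ 2 * ((m n / n : ℕ) : ℝ) ^ 3 *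
    Real.logb 2 (m n) ^ 3 / n with hY
  set P : ℕ → ℝ := fun n => (utilityLaw D n (m n)).real
    {u | ∀ σ : Equiv.Perm (Fin (m n % n)),
      IsAllocation (efxViaEF A n (m n) σ u) ∧ IsEFX u (efxViaEF A n (m n) σ u)} with hP
  have hlogm : ∀ n, 0 ≤ Real.logb 2 (m n) := fun n => by
    rcases Nat.eq_zero_or_pos (m n) with h | h
    · simp [h]
    · exact Real.logb_nonneg one_lt_two (by exact_mod_cast h)
  have hY0 : ∀ n, 0 ≤ Y n := fun n => by have := hlogm n; positivity
  have hX : ∀ᶠ n in atTop, ¬ n ∣ m n → Real.logb 2 (m n) ^ 3 / n ≤ C * Y n := by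
    filter_upwards [hm] with n hn hd
    have hq : (1 : ℝ) ≤ (m n % n : ℕ) := by
      exact_mod_cast Nat.pos_of_ne_zero fun h => hd (Nat.dvd_of_mod_eq_zero h)
    have hr : (1 : ℝ) ≤ (m n / n : ℕ) := by exact_mod_cast (by omega : 1 ≤ m n / n)
    have h0 := hlogm n
    calc Real.logb 2 (m n) ^ 3 / n = 1 * 1 * Real.logb 2 (m n) ^ 3 / n := by ring
      _ ≤ Y n := by
          simp only [hY]
          gcongr
          · exact one_le_pow₀ hq
          · exact one_le_pow₀ hr
      _ ≤ C * Y n := le_mul_of_one_le_left (hY0 n) (le_max_left _ _)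
  obtain ⟨k, hk1, hk2, hk3, hk⟩ := exists_admissible_sequence (X := fun n => C * Y n) hm hlog hX
  have hgood := hA k hk1 hk2 hk3
  -- The error is defined as the shortfall itself, so the inequality is automatic and only its
  -- convergence to zero needs proof.
  refine ⟨fun n => max 0 (1 - C * Y n - P n), ?_, Eventually.of_forall fun n => ?_⟩
  · have hupper : Tendsto (fun n : ℕ => 1 - (utilityLaw D n (k n)).real
        {u | IsGoodEnvyFree C₀ u (A.run n (k n) u)} + 1 / n) atTop (𝓝 0) := by
      simpa using (hgood.const_sub 1).add (tendsto_const_div_atTop_nhds_zero_nat (1 : ℝ))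
    refine tendsto_of_tendsto_of_tendsto_of_le_of_le' tendsto_const_nhds hupper
      (Eventually.of_forall fun n => le_max_left _ _) ?_
    filter_upwards [hm, eventually_ge_atTop 1] with n hr hn
    have hg0 : (utilityLaw D n (k n)).real {u | IsGoodEnvyFree C₀ u (A.run n (k n) u)} ≤ 1 :=
      measureReal_le_one
    have hn0 : (0 : ℝ) ≤ 1 / n := by positivity
    refine max_le (by linarith) ?_
    rcases hk n with hkn | hkn
    · have hmeas : MeasurableSet {u | IsGoodEnvyFree C₀ u (A.run n (k n) u)} := by
        have : {u | IsGoodEnvyFree C₀ u (A.run n (k n) u)} = ⋃ M : Bundles n (k n),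
            {u | A.run n (k n) u = M} ∩ {u | IsGoodEnvyFree C₀ u M} := by
          ext u; simp
        rw [this]
        exact MeasurableSet.iUnion fun M =>
          (A.measurableSet_run_eq n _ M).inter (measurableSet_isGoodEnvyFree C₀ M)
      have hC₁0 : 0 ≤ C₁ := le_max_right _ _
      have hβ : 0 ≤ β := hD.2.1.le
      have hb0 : 0 ≤ β * C₁ * (2 * β * C₁ + 2) * Y n := mul_nonneg (by positivity) (hY0 n)
      have hle : utilityLaw D n (m n) _ ≤ _ + ENNReal.ofReal (1 / n +
          β * C₁ * (2 * β * C₁ + 2) * Y n) :=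
        utilityLaw_not_efx_le hD A hn hr (le_max_left C₀ 0) hC₁0
      rw [← hkn, ← ofReal_measureReal (s := {x | IsGoodEnvyFree C₀ x (A.run n (k n) x)}ᶜ),
        probReal_compl_eq_one_sub hmeas, ← ENNReal.ofReal_add (by linarith) (by linarith)] at hle
      have := one_sub_le_measureReal (by linarith) hle
      have hCY : β * C₁ * (2 * β * C₁ + 2) * Y n ≤ C * Y n :=
        mul_le_mul_of_nonneg_right (le_max_right _ _) (hY0 n)
      linarith
    · have : 0 ≤ P n := measureReal_nonneg
      linarith
  · have := le_max_right 0 (1 - C * Y n - P n)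
    linarith

end FairDivision

theorem theorem5p4 (α β : ℝ) :
    -- an envy-free algorithm with the required guarantee exists
    (∃ (C₀ : ℝ) (A : FairDivision.AllocationAlgorithm),
      ∀ D : Measure ℝ, IsProbabilityMeasure D → FairDivision.IsPDFBounded α β D →
        FairDivision.HasEnvyFreeGuarantee D C₀ A) ∧
    -- and with any such algorithm as the subroutine, the EFX algorithm succeeds
    (∀ C₀ : ℝ, ∃ C : ℝ,
      ∀ D : Measure ℝ, IsProbabilityMeasure D → FairDivision.IsPDFBounded α β D →
      ∀ A : FairDivision.AllocationAlgorithm, FairDivision.HasEnvyFreeGuarantee D C₀ A →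
      ∀ m : ℕ → ℕ, (∀ᶠ n in atTop, 2 ≤ m n / n) →
        ((fun n : ℕ => Real.logb 2 (m n)) =o[atTop ⊓ 𝓟 {n : ℕ | n ∣ m n}]
          fun n : ℕ => (n : ℝ)) →
        ∃ ε : ℕ → ℝ, Tendsto ε atTop (𝓝 0) ∧ ∀ᶠ n in atTop,
          1 - ε n - C * (((m n % n : ℕ) : ℝ) ^ 2 * ((m n / n : ℕ) : ℝ) ^ 3 *
              Real.logb 2 (m n) ^ 3 / n) ≤
            (FairDivision.utilityLaw D n (m n)).real
              {u | ∀ σ : Equiv.Perm (Fin (m n % n)),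
                FairDivision.IsAllocation (FairDivision.efxViaEF A n (m n) σ u) ∧
                FairDivision.IsEFX u (FairDivision.efxViaEF A n (m n) σ u)}) :=
  ⟨⟨24 / α, FairDivision.exhaustiveSearch (24 / α), fun _ _ hD =>
    FairDivision.exhaustiveSearch_hasEnvyFreeGuarantee hD⟩,
    fun C₀ => FairDivision.efx_of_hasEnvyFreeGuarantee C₀⟩
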